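/- Consider one major agent (index $0$) and $n$ minor agents (indices $i \in N=\{1,\dots,n\}$), $N_0=\{0\}\cup N$, over a horizon $T\ge 1$, with states $x_i(t)\in\mathbb R^{d_x^i}$ and controls $u_i(t)\in\mathbb R^{d_u^i}$. With $x=\mathrm{vec}(x_0,\dots,x_n)$ and similarly $u,w$, the dynamics are $$x(t+1)=Ax(t)+Bu(t)+w(t),$$ where the only blocks of $A$ and $B$ that may be nonzero are $A_{ii},B_{ii}$ ($i\in N_0$) and $A_{i0},B_{i0}$ ($i\in N$). Minor agent $i\in N$ has the output $y_i(t)=C_{ii}x_i(t)+v_i(t)$. The primitive random variables $x_i(1)$, $w_i(t)$ ($i\in N_0$) and $v_i(t)$ ($i\in N$), $1\le t\le T$, are independent, have zero mean and finite variance (they need not be Gaussian). The information available to the agents at time $t$ is $$I_0(t)=\{x_0(1{:}t),u_0(1{:}t-1)\},\qquad I_i(t)=\{x_0(1{:}t),y_i(1{:}t),u_0(1{:}t-1),u_i(1{:}t-1)\},\ i\in N,$$ and a general strategy $g$ consists of measurable functions $g_{i,t}$ with $u_i(t)=g_{i,t}(I_i(t))$, $i\in N_0$. Its cost is $$J(g)=\mathbb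 E\Big[\sum_{t=1}^{T-1}\big(x(t)^\top Qx(t)+u(t)^\top Ru(t)\big)+x(T)^\top Q_Tx(T)\Big]\in[0,\infty],$$ with $Q,Q_T$ symmetric positive semidefinite and $R$ symmetric positive definite. A strategy is optimal if it minimizes $J$ over all general strategies. Let $\mathcal R(P,A,B,Q,R)=Q+A^\top PA-A^\top PB(R+B^\top PB)^{-1}B^\top PA$ and $\mathcal G(P,A,B,R)=(R+B^\top PB)^{-1}B^\top PA$. Put $S^c(T)=Q_T$, $S^\ell_i(T)=[Q_T]_{ii}$ and, for $t=T-1,\dots,1$ and $i\in N$, $$S^c(t)=\mathcal R(S^c(t+1),A,B,Q,R),\quad S^\ell_i(t)=\mathcal R(S^\ell_i(t+1),A_{ii},B_{ii},Q_{ii},R_{ii}),$$ $$L^c(t)=\mathcal G(S^c(t+1),A,B,R),\quad L^\ell_i(t)=\mathcal G(S^\ell_i(t+1),A_{ii},B_{ii},R_{ii}).$$ Let $I^c(t)=I_0(t)$ be the common information. For a strategy with integrable controls put $u^c(t)=\mathbb E[u(t)\mid I^c(t)]$, $u^\ell(t)=u(t)-u^c(t)$, and $$x^c(1)=0,\ x^c(t+1)=Ax^c(t)+Bu^c(t);\quad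 x^\ell(1)=0,\ x^\ell(t+1)=Ax^\ell(t)+Bu^\ell(t);\quad x^s(1)=x(1),\ x^s(t+1)=Ax^s(t)+w(t);$$ $$z^c(t)=x^c(t)+x^s(t),\quad z^\ell_i(t)=x^\ell_i(t)+x^s_i(t),$$ $$\hat z^c(t)=\mathbb E[z^c(t)\mid I^c(t)],\quad \hat z^\ell_i(t)=\mathbb E[z^\ell_i(t)\mid I_i(t)]-\mathbb E[z^\ell_i(t)\mid I_0(t)].$$ **Theorem.** An optimal general strategy exists and has finite cost. A general strategy is optimal if and only if, for every $t\in\{1,\dots,T-1\}$, its control $u(t)$ is integrable and, almost surely, $$u^c(t)=-L^c(t)\,\hat z^c(t)\qquad\text{and}\qquad u^\ell_i(t)=-L^\ell_i(t)\,\hat z^\ell_i(t)\quad (i\in N).$$ The optimal strategy is unique: any two optimal strategies $g,g'$ generate almost surely the same controls $u(t)$, $1\le t\le T-1$, and for these $t$ and all $i \in N_0$ one has $g_{i,t}=g'_{i,t}$ almost everywhere with respect to the distribution of $I_i(t)$ under $g$. -/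

import Mathlib

open MeasureTheory ProbabilityTheory
open scoped ENNReal Matrix

noncomputable section

namespace MajorMinor

/-- Agents: `none` is the major agent (agent `0`), `some i` is a minor agent. -/
abbrev Agent (n : ℕ) := Option (Fin n)

/-- Stacked vectors `vec(x_0, …, x_n)` with blocks of dimensions `d 0, …, d n`. -/
abbrev Stacked {n : ℕ} (d : Agent n → ℕ) := (Σ i, Fin (d i)) → ℝ

/-- Block matrices with row blocks of sizes `d i` and column blocks of sizes `e j`. -/
abbrev BlockMatrix {n : ℕ} (d e : Agent n → ℕ) := Matrix (Σ i, Fin (d i)) (Σ j, Fin (e j)) ℝ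

/-- The `i`-th block of a stacked vector. -/
def blk {n : ℕ} {d : Agent n → ℕ} (x : Stacked d) (i : Agent n) : Fin (d i) → ℝ :=
  fun a => x ⟨i, a⟩

/-- The diagonal block `M_{ii}`. -/
def diagBlk {n : ℕ} {d e : Agent n → ℕ} (M : BlockMatrix d e) (i : Agent n) :
    Matrix (Fin (d i)) (Fin (e i)) ℝ :=
  M.submatrix (fun a => ⟨i, a⟩) (fun a => ⟨i, a⟩)

/-- The Riccati operator
`Q + Aᵀ P A - Aᵀ P B (R + Bᵀ P B)⁻¹ Bᵀ P A`. -/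
def riccatiOp {k l : Type*} [Fintype k] [Fintype l] [DecidableEq l]
    (P A : Matrix k k ℝ) (B : Matrix k l ℝ) (Q : Matrix k k ℝ) (R : Matrix l l ℝ) :
    Matrix k k ℝ :=
  Q + Aᵀ * P * A - Aᵀ * P * B * (R + Bᵀ * P * B)⁻¹ * Bᵀ * P * A

/-- The gain operator `(R + Bᵀ P B)⁻¹ Bᵀ P A`. -/
def gainOp {k l : Type*} [Fintype k] [Fintype l] [DecidableEq l]
    (P A : Matrix k k ℝ) (B : Matrix k l ℝ) (R : Matrix l l ℝ) : Matrix l k ℝ :=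
  (R + Bᵀ * P * B)⁻¹ * Bᵀ * P * A

/-- The Riccati recursion with `k` steps to go, starting from the terminal weight `QT`. -/
def riccatiToGo {k l : Type*} [Fintype k] [Fintype l] [DecidableEq l]
    (A : Matrix k k ℝ) (B : Matrix k l ℝ) (Q QT : Matrix k k ℝ) (R : Matrix l l ℝ) :
    ℕ → Matrix k k ℝ
  | 0 => QT
  | m + 1 => riccatiOp (riccatiToGo A B Q QT R m) A B Q R

/-- The deterministic data of the system with one major and `n` minor agents.

Time is counted from `0`: index `t` stands for time `t + 1` in the convention where the first
instant is `1`. The horizon is `T = N + 1`, so that states live at `0, …, N`, decisions that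
matter for the cost are taken at `0, …, N - 1`, and `N` is the terminal instant. -/
structure System (n : ℕ) where
  /-- number of decision stages, `T - 1` -/
  N : ℕ
  dx : Agent n → ℕ
  du : Agent n → ℕ
  dy : Fin n → ℕ
  A : BlockMatrix dx dx
  B : BlockMatrix dx du
  /-- observation matrix `C_{ii}` of minor agent `i` -/
  C : ∀ i : Fin n, Matrix (Fin (dy i)) (Fin (dx (some i))) ℝ
  Q : BlockMatrix dx dx
  QT : BlockMatrix dx dx
  R : BlockMatrix du du
  /-- only the blocks `A_{ii}` and `A_{i0}` may be nonzero -/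
  A_sparse : ∀ p q, q.1 ≠ p.1 → q.1 ≠ none → A p q = 0
  /-- only the blocks `B_{ii}` and `B_{i0}` may be nonzero -/
  B_sparse : ∀ p q, q.1 ≠ p.1 → q.1 ≠ none → B p q = 0
  Q_psd : Q.PosSemidef
  QT_psd : QT.PosSemidef
  R_pd : R.PosDef

variable {n : ℕ}

/-! ### Gains -/

/-- `S^c(t)`: `S^c(N) = Q_T`, and the backward Riccati recursion for `t < N`. -/
def System.Scom (S : System n) (t : ℕ) : BlockMatrix S.dx S.dx :=
  riccatiToGo S.A S.B S.Q S.QT S.R (S.N - t)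

/-- `S^ℓ_i(t)`. -/
def System.Sloc (S : System n) (i : Fin n) (t : ℕ) :
    Matrix (Fin (S.dx (some i))) (Fin (S.dx (some i))) ℝ :=
  riccatiToGo (diagBlk S.A (some i)) (diagBlk S.B (some i)) (diagBlk S.Q (some i))
    (diagBlk S.QT (some i)) (diagBlk S.R (some i)) (S.N - t)

/-- `L^c(t)`, for `t < N`. -/
def System.Lcom (S : System n) (t : ℕ) : BlockMatrix S.du S.dx :=
  gainOp (S.Scom (t + 1)) S.A S.B S.R

/-- `L^ℓ_i(t)`, for `t < N`. -/
def System.Lloc (S : System n) (i : Fin n) (t : ℕ) :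
    Matrix (Fin (S.du (some i))) (Fin (S.dx (some i))) ℝ :=
  gainOp (S.Sloc i (t + 1)) (diagBlk S.A (some i)) (diagBlk S.B (some i)) (diagBlk S.R (some i))

/-! ### Primitive random variables -/

/-- The primitive random variables: initial states, process noises, observation noises. -/
structure Primitives (S : System n) (Ω : Type*) where
  x1 : ∀ i : Agent n, Ω → Fin (S.dx i) → ℝ
  w : ∀ i : Agent n, ℕ → Ω → Fin (S.dx i) → ℝ
  v : ∀ i : Fin n, ℕ → Ω → Fin (S.dy i) → ℝ

/-- Labels of the primitive random variables over the horizon. -/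
inductive PrimIdx (n N : ℕ) : Type
  | init (i : Agent n) : PrimIdx n N
  | process (i : Agent n) (t : Fin (N + 1)) : PrimIdx n N
  | obs (i : Fin n) (t : Fin (N + 1)) : PrimIdx n N

/-- Dimension of a primitive random variable. -/
def primDim (S : System n) : PrimIdx n S.N → ℕ
  | .init i => S.dx i
  | .process i _ => S.dx i
  | .obs i _ => S.dy i

variable {S : System n} {Ω : Type*}

/-- The primitive random variables over the horizon as one family. -/
def Primitives.fam (ξ : Primitives S Ω) : ∀ p : PrimIdx n S.N, Ω → Fin (primDim S p) → ℝ
  | .init i => ξ.x1 i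
  | .process i t => ξ.w i t
  | .obs i t => ξ.v i t

/-- The primitive random variables are independent, with zero mean and finite variance. -/
structure Primitives.Standard [MeasurableSpace Ω] (ξ : Primitives S Ω) (μ : Measure Ω) :
    Prop where
  measurable : ∀ p, Measurable (ξ.fam p)
  indep : iIndepFun ξ.fam μ
  memLp : ∀ p, MemLp (ξ.fam p) 2 μ
  mean_zero : ∀ p, ∫ ω, ξ.fam p ω ∂μ = 0

/-- `x(1) = vec(x_0(1), …, x_n(1))`. -/
def Primitives.x1vec (ξ : Primitives S Ω) (ω : Ω) : Stacked S.dx := fun p => ξ.x1 p.1 ω p.2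

/-- `w(t) = vec(w_0(t), …, w_n(t))`. -/
def Primitives.wvec (ξ : Primitives S Ω) (t : ℕ) (ω : Ω) : Stacked S.dx :=
  fun p => ξ.w p.1 t ω p.2

/-! ### Dynamics and information -/

/-- The state `x(t)` under a sequence of control inputs. -/
def Primitives.stateOf (ξ : Primitives S Ω) (us : ℕ → Stacked S.du) (ω : Ω) : ℕ → Stacked S.dx
  | 0 => ξ.x1vec ω
  | t + 1 => S.A *ᵥ ξ.stateOf us ω t + S.B *ᵥ us t + ξ.wvec t ω

/-- The output `y_i(t) = C_{ii} x_i(t) + v_i(t)` under a sequence of control inputs. -/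
def Primitives.outputOf (ξ : Primitives S Ω) (us : ℕ → Stacked S.du) (ω : Ω) (i : Fin n)
    (t : ℕ) : Fin (S.dy i) → ℝ :=
  S.C i *ᵥ blk (ξ.stateOf us ω t) (some i) + ξ.v i t ω

/-- Values of `I_0(t)`: the history of `x_0` up to `t` and of `u_0` before `t`. -/
abbrev InfoMajor (S : System n) (t : ℕ) :=
  (Fin (t + 1) → Fin (S.dx none) → ℝ) × (Fin t → Fin (S.du none) → ℝ)

/-- Values of `I_i(t)`: those of `I_0(t)`, the history of `y_i` up to `t` and of `u_i`
before `t`. -/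
abbrev InfoMinor (S : System n) (i : Fin n) (t : ℕ) :=
  InfoMajor S t × (Fin (t + 1) → Fin (S.dy i) → ℝ) × (Fin t → Fin (S.du (some i)) → ℝ)

/-- `I_0(t)` under a sequence of control inputs. -/
def Primitives.infoMajorOf (ξ : Primitives S Ω) (us : ℕ → Stacked S.du) (ω : Ω) (t : ℕ) :
    InfoMajor S t :=
  (fun s => blk (ξ.stateOf us ω s) none, fun s => blk (us s) none)

/-- `I_i(t)` under a sequence of control inputs. -/
def Primitives.infoMinorOf (ξ : Primitives S Ω) (us : ℕ → Stacked S.du) (ω : Ω) (i : Fin n)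
    (t : ℕ) : InfoMinor S i t :=
  (ξ.infoMajorOf us ω t, fun s => ξ.outputOf us ω i s, fun s => blk (us s) (some i))

/-! ### Strategies and the closed loop -/

/-- General control strategies: measurable control laws `g_{i,t}` of the information `I_i(t)`. -/
structure Strategy (S : System n) where
  major : ∀ t, InfoMajor S t → Fin (S.du none) → ℝ
  minor : ∀ (i : Fin n) (t : ℕ), InfoMinor S i t → Fin (S.du (some i)) → ℝ
  measurable_major : ∀ t, Measurable (major t)
  measurable_minor : ∀ i t, Measurable (minor i t)

/-- The action that `g` prescribes at time `t` when the inputs so far are `us`; only the values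
`us s` with `s < t` matter. -/
def Strategy.act (g : Strategy S) (ξ : Primitives S Ω) (us : ℕ → Stacked S.du) (ω : Ω)
    (t : ℕ) : Stacked S.du
  | ⟨none, a⟩ => g.major t (ξ.infoMajorOf us ω t) a
  | ⟨some i, a⟩ => g.minor i t (ξ.infoMinorOf us ω i t) a

/-- The control process `u(t)` generated by `g`; see `Strategy.control_eq`. -/
def Strategy.control (g : Strategy S) (ξ : Primitives S Ω) (t : ℕ) (ω : Ω) : Stacked S.du :=
  g.act ξ (fun s => if _h : s < t then g.control ξ s ω else 0) ω t
termination_by t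

theorem Primitives.stateOf_congr (ξ : Primitives S Ω) (ω : Ω) {us us' : ℕ → Stacked S.du} :
    ∀ {t : ℕ}, (∀ s < t, us s = us' s) → ξ.stateOf us ω t = ξ.stateOf us' ω t
  | 0, _ => rfl
  | t + 1, h => by
    simp only [Primitives.stateOf]
    rw [ξ.stateOf_congr ω (t := t) fun s hs => h s (by omega), h t (by omega)]

theorem Strategy.act_congr (g : Strategy S) (ξ : Primitives S Ω) (ω : Ω)
    {us us' : ℕ → Stacked S.du} {t : ℕ} (h : ∀ s < t, us s = us' s) :
    g.act ξ us ω t = g.act ξ us' ω t := by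
  have hst : ∀ s : Fin (t + 1), ξ.stateOf us ω s = ξ.stateOf us' ω s := fun s =>
    ξ.stateOf_congr ω fun r hr => h r (by omega)
  have hu : ∀ s : Fin t, us s = us' s := fun s => h s s.2
  have h0 : ξ.infoMajorOf us ω t = ξ.infoMajorOf us' ω t := by
    simp [Primitives.infoMajorOf, hst, hu]
  have hi : ∀ i, ξ.infoMinorOf us ω i t = ξ.infoMinorOf us' ω i t := fun i => by
    simp [Primitives.infoMinorOf, Primitives.outputOf, h0, hst, hu]
  funext p
  rcases p with ⟨_ | i, a⟩
  · simp [Strategy.act, h0]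
  · simp [Strategy.act, hi]

/-- The closed-loop equation `u_i(t) = g_{i,t}(I_i(t))`. -/
theorem Strategy.control_eq (g : Strategy S) (ξ : Primitives S Ω) (t : ℕ) (ω : Ω) :
    g.control ξ t ω = g.act ξ (fun s => g.control ξ s ω) ω t := by
  rw [Strategy.control]
  exact g.act_congr ξ ω fun s hs => by simp [hs]

/-- The closed-loop state `x(t)`. -/
def Strategy.state (g : Strategy S) (ξ : Primitives S Ω) (t : ℕ) (ω : Ω) : Stacked S.dx :=
  ξ.stateOf (fun s => g.control ξ s ω) ω t

/-- The closed-loop information `I_0(t)`, which is also the common information `I^c(t)`. -/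
def Strategy.infoMajor (g : Strategy S) (ξ : Primitives S Ω) (t : ℕ) (ω : Ω) : InfoMajor S t :=
  ξ.infoMajorOf (fun s => g.control ξ s ω) ω t

/-- The closed-loop information `I_i(t)` of minor agent `i`. -/
def Strategy.infoMinor (g : Strategy S) (ξ : Primitives S Ω) (i : Fin n) (t : ℕ) (ω : Ω) :
    InfoMinor S i t :=
  ξ.infoMinorOf (fun s => g.control ξ s ω) ω i t

/-- The sigma-algebra generated by `I_0(t) = I^c(t)`. -/
@[reducible] def Strategy.sigmaCom (g : Strategy S) (ξ : Primitives S Ω) (t : ℕ) : MeasurableSpace Ω :=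
  MeasurableSpace.comap (g.infoMajor ξ t) inferInstance

/-- The sigma-algebra generated by `I_i(t)`. -/
@[reducible] def Strategy.sigmaMinor (g : Strategy S) (ξ : Primitives S Ω) (i : Fin n) (t : ℕ) :
    MeasurableSpace Ω :=
  MeasurableSpace.comap (g.infoMinor ξ i t) inferInstance

/-! ### Cost -/

/-- The realized total cost. -/
def Strategy.pathCost (g : Strategy S) (ξ : Primitives S Ω) (ω : Ω) : ℝ :=
  ∑ t ∈ Finset.range S.N,
      (g.state ξ t ω ⬝ᵥ (S.Q *ᵥ g.state ξ t ω) + g.control ξ t ω ⬝ᵥ (S.R *ᵥ g.control ξ t ω))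
    + g.state ξ S.N ω ⬝ᵥ (S.QT *ᵥ g.state ξ S.N ω)

/-! ### Linear recursions for the state components -/

/-- The solution of `x(t+1) = A x(t) + B u(t)` with zero initial state. -/
def driven (S : System n) (u : ℕ → Ω → Stacked S.du) : ℕ → Ω → Stacked S.dx
  | 0 => fun _ => 0
  | t + 1 => fun ω => S.A *ᵥ driven S u t ω + S.B *ᵥ u t ω

/-- `x^s(t)`. -/
def Primitives.xsto (ξ : Primitives S Ω) : ℕ → Ω → Stacked S.dx
  | 0 => fun ω => ξ.x1vec ω
  | t + 1 => fun ω => S.A *ᵥ ξ.xsto t ω + ξ.wvec t ω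

variable [MeasurableSpace Ω]

/-- The expected total cost `J(g)`. The realized cost is nonnegative, so its expectation always
makes sense in `[0, ∞]`. -/
def Strategy.J (g : Strategy S) (ξ : Primitives S Ω) (μ : Measure Ω) : ℝ≥0∞ :=
  ∫⁻ ω, ENNReal.ofReal (g.pathCost ξ ω) ∂μ

/-- `g` minimizes the expected total cost over all general control strategies. -/
def Strategy.IsOptimal (g : Strategy S) (ξ : Primitives S Ω) (μ : Measure Ω) : Prop :=
  ∀ g' : Strategy S, g.J ξ μ ≤ g'.J ξ μ

/-! ### Common/local split -/

/-- `u^c(t) = E[u(t) | I^c(t)]`. -/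
def Strategy.ucom (g : Strategy S) (ξ : Primitives S Ω) (μ : Measure Ω) (t : ℕ) :
    Ω → Stacked S.du :=
  μ[g.control ξ t | g.sigmaCom ξ t]

/-- `u^ℓ(t) = u(t) - u^c(t)`. -/
def Strategy.uloc (g : Strategy S) (ξ : Primitives S Ω) (μ : Measure Ω) (t : ℕ) (ω : Ω) :
    Stacked S.du :=
  g.control ξ t ω - g.ucom ξ μ t ω

/-- `x^c(t)`. -/
def Strategy.xcom (g : Strategy S) (ξ : Primitives S Ω) (μ : Measure Ω) :
    ℕ → Ω → Stacked S.dx :=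
  driven S (g.ucom ξ μ)

/-- `x^ℓ(t)`. -/
def Strategy.xloc (g : Strategy S) (ξ : Primitives S Ω) (μ : Measure Ω) :
    ℕ → Ω → Stacked S.dx :=
  driven S (g.uloc ξ μ)

/-- `z^c(t) = x^c(t) + x^s(t)`. -/
def Strategy.zcom (g : Strategy S) (ξ : Primitives S Ω) (μ : Measure Ω) (t : ℕ) (ω : Ω) :
    Stacked S.dx :=
  g.xcom ξ μ t ω + ξ.xsto t ω

/-- `z^ℓ_i(t) = x^ℓ_i(t) + x^s_i(t)`. -/
def Strategy.zloc (g : Strategy S) (ξ : Primitives S Ω) (μ : Measure Ω) (i : Fin n) (t : ℕ)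
    (ω : Ω) : Fin (S.dx (some i)) → ℝ :=
  blk (g.xloc ξ μ t ω) (some i) + blk (ξ.xsto t ω) (some i)

/-- `ẑ^c(t) = E[z^c(t) | I^c(t)]`. -/
def Strategy.zhatCom (g : Strategy S) (ξ : Primitives S Ω) (μ : Measure Ω) (t : ℕ) :
    Ω → Stacked S.dx :=
  μ[g.zcom ξ μ t | g.sigmaCom ξ t]

/-- `ẑ^ℓ_i(t) = E[z^ℓ_i(t) | I_i(t)] - E[z^ℓ_i(t) | I_0(t)]`. -/
def Strategy.zhatLoc (g : Strategy S) (ξ : Primitives S Ω) (μ : Measure Ω) (i : Fin n) (t : ℕ) :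
    Ω → Fin (S.dx (some i)) → ℝ :=
  μ[g.zloc ξ μ i t | g.sigmaMinor ξ i t] - μ[g.zloc ξ μ i t | g.sigmaCom ξ t]

end MajorMinor

end

namespace MajorMinor

/-! ### Conditional expectations and independence -/

section CondExp

variable {Ω E : Type*} [NormedAddCommGroup E] [NormedSpace ℝ E] [CompleteSpace E]
  {m₀ : MeasurableSpace Ω} {μ : Measure Ω}

/-! The proof writes the expected cost as a constant plus nonnegative squares that vanish exactly
under the stated feedback. Three facts make this possible.

No control influences information. By the sparsity of `A` and `B`, `x_0` feels only `u_0`, and `x_i`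
feels only `u_0` and `u_i`, so each agent can subtract the effect of the recorded inputs from its
observations. Hence the information sigma-algebras are the same under all strategies
(`Strategy.sigmaCom_eq`, `Strategy.sigmaMinor_eq`), and strategies amount to processes adapted to
fixed sigma-algebras (`Primitives.exists_strategy`).

Given the common information, the agents are independent. The common information is generated by the
noise of the major agent (`Primitives.sigMajor_eq`), and two minor agents share no other primitive
variables; `Primitives.Standard.condExp_sig` turns such statements about index sets into identities
of conditional expectations. Controls and states split into a common part and local parts centered
given the common information, and these parts are all mutually orthogonal. A quadratic cost
therefore separates into one common problem with the full matrices and one problem per minor agent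
with the diagonal blocks (`IsSplit.integral_quadForm`). Only second moments and independence enter,
so no Gaussian assumption is needed.

Each of these problems is linear-quadratic, and squares are completed along the Riccati recursion
(`lq_cost_eq`). The common state is known to all agents. A local state is not observed, but its
controlled part is known to its agent, so the estimation error does not depend on the strategy; it
is orthogonal to everything the agent knows and contributes a constant
(`Strategy.integral_local_square`). This gives `Strategy.integral_pathCost`, with positive definite
weights on the deviations from the feedback.

For the conclusion, finite cost forces square integrable controls because `R` is positive definite
(`Strategy.memLp_control_of_J_ne_top`); a strategy with zero deviations exists
(`Primitives.Standard.exists_isFeedback`); so optimality means zero deviations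
(`Strategy.isOptimal_iff_isFeedback`). Zero deviations determine the controls by induction on time
(`Strategy.IsFeedback.control_ae_eq`). -/

theorem setIntegral_eq_smul_integral_of_indep [IsProbabilityMeasure μ]
    {m₁ m₂ : MeasurableSpace Ω} (h₁ : m₁ ≤ m₀) (h₂ : m₂ ≤ m₀) (hind : Indep m₁ m₂ μ) {Z : Ω → E} (hZ : StronglyMeasurable[m₁] Z)
    (hZi : Integrable Z μ) {s : Set Ω} (hs : MeasurableSet[m₂] s) :
    ∫ ω in s, Z ω ∂μ = μ.real s • ∫ ω, Z ω ∂μ := by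
  rw [← setIntegral_condExp h₂ hZi hs,
    setIntegral_congr_ae (g := fun _ => ∫ ω, Z ω ∂μ) (h₂ _ hs)
      ((condExp_indep_eq h₁ h₂ hZ hind).mono fun _ h _ => h), setIntegral_const]

/-- Conditioning additionally on a sigma-algebra which is independent of everything in sight
does not change a conditional expectation. -/
theorem condExp_sup_of_indep [IsProbabilityMeasure μ] {m₁ m₂ m : MeasurableSpace Ω}
    (h₁ : m₁ ≤ m₀) (h₂ : m₂ ≤ m₀) (hm : m ≤ m₁) (hind : Indep m₁ m₂ μ)
    {X : Ω → E} (hX : StronglyMeasurable[m₁] X) :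
    μ[X | m ⊔ m₂] =ᵐ[μ] μ[X | m] := by
  by_cases hXi : Integrable X μ
  swap
  · rw [condExp_of_not_integrable hXi, condExp_of_not_integrable hXi]
  have hle : m ⊔ m₂ ≤ m₀ := sup_le (hm.trans h₁) h₂
  have hci : Integrable (μ[X | m]) μ := integrable_condExp
  have hcm : StronglyMeasurable[m₁] (μ[X | m]) := stronglyMeasurable_condExp.mono hm
  refine (ae_eq_condExp_of_forall_setIntegral_eq hle hXi (fun s _ _ => hci.integrableOn) ?_
    (stronglyMeasurable_condExp.mono le_sup_left).aestronglyMeasurable).symm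
  -- Intersections of sets from the two sigma-algebras form a π-system generating `m ⊔ m₂`. On such
  -- a set independence factors out the probability of the `m₂`-part, and the `m`-part is covered by
  -- the definition of `μ[X | m]`.
  let C : Set (Set Ω) :=
    Set.image2 (· ∩ ·) {s | MeasurableSet[m] s} {s | MeasurableSet[m₂] s}
  have hC : m ⊔ m₂ = MeasurableSpace.generateFrom C := by
    apply le_antisymm
    · refine sup_le (fun s hs => ?_) (fun s hs => ?_)
      · exact MeasurableSpace.measurableSet_generateFrom
          ⟨s, hs, Set.univ, MeasurableSet.univ, Set.inter_univ s⟩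
      · exact MeasurableSpace.measurableSet_generateFrom
          ⟨Set.univ, MeasurableSet.univ, s, hs, Set.univ_inter s⟩
    · refine MeasurableSpace.generateFrom_le ?_
      rintro _ ⟨a, ha, b, hb, rfl⟩
      exact MeasurableSet.inter ((le_sup_left : m ≤ m ⊔ m₂) _ ha)
        ((le_sup_right : m₂ ≤ m ⊔ m₂) _ hb)
  have hpi : IsPiSystem C := by
    rintro _ ⟨a, ha, b, hb, rfl⟩ _ ⟨a', ha', b', hb', rfl⟩ _
    exact ⟨a ∩ a', MeasurableSet.inter ha ha', b ∩ b', MeasurableSet.inter hb hb',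
      Set.inter_inter_inter_comm ..⟩
  intro s hs _
  induction s, hs using MeasurableSpace.induction_on_inter hC hpi with
  | empty => simp
  | basic t ht =>
    obtain ⟨a, ha, b, hb, rfl⟩ := ht
    have key : ∀ Y : Ω → E, StronglyMeasurable[m₁] Y → Integrable Y μ →
        ∫ ω in a ∩ b, Y ω ∂μ = μ.real b • ∫ ω in a, Y ω ∂μ := by
      intro Y hY hYi
      have ha₀ : MeasurableSet[m₀] a := h₁ _ (hm _ ha)
      rw [← integral_indicator ha₀, ← setIntegral_eq_smul_integral_of_indep h₁ h₂ hind
        (hY.indicator (hm _ ha)) (hYi.indicator ha₀) hb, setIntegral_indicator ha₀,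
        Set.inter_comm]
    rw [key _ hcm hci, key _ hX hXi, setIntegral_condExp (hm.trans h₁) hXi ha]
  | compl t ht ih =>
    have e₁ := integral_add_compl (hle _ ht) hci
    have e₂ := integral_add_compl (hle _ ht) hXi
    rw [ih (measure_lt_top _ _), integral_condExp (hm.trans h₁)] at e₁
    exact add_left_cancel (e₁.trans e₂.symm)
  | iUnion f hd hf ih =>
    rw [integral_iUnion (fun i => hle _ (hf i)) hd hci.integrableOn,
      integral_iUnion (fun i => hle _ (hf i)) hd hXi.integrableOn]
    exact tsum_congr fun i => ih i (measure_lt_top _ _)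

theorem condExp_eval {ι : Type*} [Fintype ι] {m : MeasurableSpace Ω} {X : Ω → ι → ℝ}
    (hX : Integrable X μ) (p : ι) :
    (fun ω => (μ[X | m]) ω p) =ᵐ[μ] μ[fun ω => X ω p | m] :=
  (ContinuousLinearMap.proj (R := ℝ) (φ := fun _ : ι => ℝ) p).comp_condExp_comm hX

theorem condExp_mulVec {ι κ : Type*} [Fintype ι] [Fintype κ] {m : MeasurableSpace Ω}
    {X : Ω → ι → ℝ} (hX : Integrable X μ) (M : Matrix κ ι ℝ) :
    (fun ω => M *ᵥ (μ[X | m]) ω) =ᵐ[μ] μ[fun ω => M *ᵥ X ω | m] :=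
  (LinearMap.toContinuousLinearMap (Matrix.mulVecLin M)).comp_condExp_comm hX

end CondExp

/-! ### Square integrable vectors -/

section SquareIntegrable

variable {Ω : Type*} {m₀ : MeasurableSpace Ω} {μ : Measure Ω}
  {ι κ τ : Type*} [Fintype ι] [Fintype κ]

theorem memLp_mulVec {X : Ω → ι → ℝ} (hX : MemLp X 2 μ) (M : Matrix κ ι ℝ) :
    MemLp (fun ω => M *ᵥ X ω) 2 μ :=
  (LinearMap.toContinuousLinearMap (Matrix.mulVecLin M)).comp_memLp' hX

theorem integrable_mul_eval {X : Ω → ι → ℝ} {Y : Ω → κ → ℝ} (hX : MemLp X 2 μ)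
    (hY : MemLp Y 2 μ) (p : ι) (q : κ) : Integrable (fun ω => X ω p * Y ω q) μ :=
  (hX.eval p).integrable_mul (hY.eval q)

theorem integrable_dotProduct {X Y : Ω → ι → ℝ} (hX : MemLp X 2 μ) (hY : MemLp Y 2 μ) :
    Integrable (fun ω => X ω ⬝ᵥ Y ω) μ := by
  simp only [dotProduct]
  exact integrable_finsetSum _ fun p _ => integrable_mul_eval hX hY p p

theorem integrable_dotProduct_mulVec {X : Ω → ι → ℝ} {Y : Ω → κ → ℝ} (hX : MemLp X 2 μ)
    (hY : MemLp Y 2 μ) (M : Matrix ι κ ℝ) : Integrable (fun ω => X ω ⬝ᵥ (M *ᵥ Y ω)) μ :=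
  integrable_dotProduct hX (memLp_mulVec hY M)

/-- All components of `X` are orthogonal to all components of `Y`. -/
def Orth {α β : Type*} (μ : Measure Ω) (X : Ω → α → ℝ) (Y : Ω → β → ℝ) : Prop :=
  ∀ p q, ∫ ω, X ω p * Y ω q ∂μ = 0

theorem Orth.integral_dotProduct {X Y : Ω → ι → ℝ} (h : Orth μ X Y) (hX : MemLp X 2 μ)
    (hY : MemLp Y 2 μ) : ∫ ω, X ω ⬝ᵥ Y ω ∂μ = 0 := by
  simp only [dotProduct]
  rw [integral_finsetSum _ fun p _ => integrable_mul_eval hX hY p p]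
  exact Finset.sum_eq_zero fun p _ => h p p

theorem Orth.mulVec_right {X : Ω → ι → ℝ} {Y : Ω → κ → ℝ} (h : Orth μ X Y) (hX : MemLp X 2 μ)
    (hY : MemLp Y 2 μ) (M : Matrix τ κ ℝ) : Orth μ X fun ω => M *ᵥ Y ω := by
  intro p q
  simp only [Matrix.mulVec, dotProduct, Finset.mul_sum]
  simp only [mul_left_comm (X _ p)]
  rw [integral_finsetSum _ fun r _ => (integrable_mul_eval hX hY p r).const_mul _]
  exact Finset.sum_eq_zero fun r _ => by rw [integral_const_mul, h p r, mul_zero]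

theorem Orth.add_right {X : Ω → ι → ℝ} {Y Z : Ω → κ → ℝ} (h : Orth μ X Y) (h' : Orth μ X Z)
    (hX : MemLp X 2 μ) (hY : MemLp Y 2 μ) (hZ : MemLp Z 2 μ) :
    Orth μ X fun ω => Y ω + Z ω := by
  intro p q
  simp only [Pi.add_apply, mul_add]
  rw [integral_add (integrable_mul_eval hX hY p q) (integrable_mul_eval hX hZ p q),
    h p q, h' p q, add_zero]

/-- The known factor is pulled out of the conditional expectation of the product, which leaves zero.
Every orthogonality used below goes back to this. -/
theorem orth_of_condExp_eq_zero [IsProbabilityMeasure μ] {m : MeasurableSpace Ω} (hm : m ≤ m₀)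
    {X : Ω → ι → ℝ} {Y : Ω → κ → ℝ} (hX : MemLp X 2 μ) (hY : MemLp Y 2 μ)
    (h0 : μ[X | m] =ᵐ[μ] 0) (hYm : StronglyMeasurable[m] Y) : Orth μ X Y := by
  intro p q
  have hXi : Integrable X μ := hX.integrable (by norm_num)
  have hYq : StronglyMeasurable[m] fun ω => Y ω q :=
    (continuous_apply q).comp_stronglyMeasurable hYm
  have hz : μ[fun ω => X ω p | m] =ᵐ[μ] 0 := by
    filter_upwards [condExp_eval (m := m) hXi p, h0] with ω h₁ h₂
    rw [← h₁, h₂]; rfl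
  rw [← integral_condExp hm]
  refine (integral_congr_ae ?_).trans (integral_zero Ω ℝ)
  filter_upwards [condExp_mul_of_stronglyMeasurable_right (m := m) hYq
    ((hX.eval p).integrable_mul (hY.eval q)) (hXi.eval p), hz] with ω h₁ h₂
  rw [show (fun ω => X ω p * Y ω q) = (fun ω => X ω p) * fun ω => Y ω q from rfl, h₁,
    Pi.mul_apply, h₂, Pi.zero_apply, zero_mul]

theorem orth_of_indep [IsProbabilityMeasure μ] {m₁ m₂ : MeasurableSpace Ω} (h₁ : m₁ ≤ m₀)
    (h₂ : m₂ ≤ m₀) (hind : Indep m₁ m₂ μ) {X : Ω → ι → ℝ} {Y : Ω → κ → ℝ}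
    (hX : MemLp X 2 μ) (hY : MemLp Y 2 μ) (hXm : StronglyMeasurable[m₁] X)
    (hYm : StronglyMeasurable[m₂] Y) (h0 : ∫ ω, X ω ∂μ = 0) : Orth μ X Y := by
  refine orth_of_condExp_eq_zero h₂ hX hY ?_ hYm
  filter_upwards [condExp_indep_eq h₁ h₂ hXm hind] with ω hω
  rw [hω, h0]; rfl

end SquareIntegrable

/-! ### Completing the square -/

section Riccati

variable {k l : Type*} [Fintype k] [Fintype l]

theorem mulVec_dotProduct_eq (A : Matrix k l ℝ) (x : l → ℝ) (y : k → ℝ) :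
    (A *ᵥ x) ⬝ᵥ y = x ⬝ᵥ (Aᵀ *ᵥ y) := by
  rw [Matrix.dotProduct_mulVec, Matrix.vecMul_transpose]

theorem dotProduct_mulVec_comm {P : Matrix k k ℝ} (hP : P.IsHermitian) (x y : k → ℝ) :
    x ⬝ᵥ (P *ᵥ y) = y ⬝ᵥ (P *ᵥ x) := by
  have hP' : Pᵀ = P := hP
  rw [← dotProduct_comm, mulVec_dotProduct_eq, hP']

theorem quadForm_add {P : Matrix k k ℝ} (hP : P.IsHermitian) (x y : k → ℝ) :
    (x + y) ⬝ᵥ (P *ᵥ (x + y))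
      = x ⬝ᵥ (P *ᵥ x) + y ⬝ᵥ (P *ᵥ y) + 2 * (y ⬝ᵥ (P *ᵥ x)) := by
  rw [Matrix.mulVec_add, dotProduct_add, add_dotProduct, add_dotProduct,
    dotProduct_mulVec_comm hP x y]
  ring

theorem posSemidef_quadForm_nonneg {P : Matrix k k ℝ} (hP : P.PosSemidef) (x : k → ℝ) :
    0 ≤ x ⬝ᵥ (P *ᵥ x) := by
  simpa using hP.dotProduct_mulVec_nonneg x

theorem posDef_quadForm_eq_zero {P : Matrix k k ℝ} (hP : P.PosDef) {x : k → ℝ}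
    (hx : x ⬝ᵥ (P *ᵥ x) = 0) : x = 0 := by
  by_contra h
  have := hP.dotProduct_mulVec_pos h
  simp only [star_trivial] at this
  exact this.ne' hx

/-- The weight `R + Bᵀ P B` of the completed square. -/
def gainWeight (P : Matrix k k ℝ) (B : Matrix k l ℝ) (R : Matrix l l ℝ) : Matrix l l ℝ :=
  R + Bᵀ * P * B

theorem gainWeight_posDef {P : Matrix k k ℝ} (hP : P.PosSemidef) (B : Matrix k l ℝ)
    {R : Matrix l l ℝ} (hR : R.PosDef) : (gainWeight P B R).PosDef :=
  hR.add_posSemidef (by simpa using hP.conjTranspose_mul_mul_same B)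

theorem integral_quadForm_add {Ω : Type*} {m₀ : MeasurableSpace Ω} {μ : Measure Ω}
    {P : Matrix k k ℝ} (hP : P.IsHermitian) {X Y : Ω → k → ℝ} (hX : MemLp X 2 μ)
    (hY : MemLp Y 2 μ) (h : Orth μ Y X) :
    ∫ ω, (X ω + Y ω) ⬝ᵥ (P *ᵥ (X ω + Y ω)) ∂μ
      = (∫ ω, X ω ⬝ᵥ (P *ᵥ X ω) ∂μ) + ∫ ω, Y ω ⬝ᵥ (P *ᵥ Y ω) ∂μ := by
  have hXX := integrable_dotProduct_mulVec hX hX P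
  have hYY := integrable_dotProduct_mulVec hY hY P
  have hYX := (integrable_dotProduct_mulVec hY hX P).const_mul 2
  have hXY : Integrable (fun ω => X ω ⬝ᵥ (P *ᵥ X ω) + Y ω ⬝ᵥ (P *ᵥ Y ω)) μ := hXX.add hYY
  simp only [quadForm_add hP]
  rw [integral_add hXY hYX, integral_add hXX hYY, integral_const_mul,
    (h.mulVec_right hY hX P).integral_dotProduct hY (memLp_mulVec hX P), mul_zero, add_zero]

variable [DecidableEq l]

/-- This is Cauchy–Schwarz for the inner product of `R`, in which the coordinate `u p` is the
product of `u` with `R⁻¹ e_p`. It bounds each squared control coordinate by the running cost. -/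
theorem posDef_quadForm_coercive {R : Matrix l l ℝ} (hR : R.PosDef) (p : l) (u : l → ℝ) :
    u p ^ 2 ≤ R⁻¹ p p * (u ⬝ᵥ (R *ᵥ u)) := by
  have hpos : 0 < R⁻¹ p p := hR.inv.diag_pos
  have hdet : IsUnit R.det := (Matrix.isUnit_iff_isUnit_det R).1 hR.isUnit
  set e : l → ℝ := Pi.single p 1
  have hRe : R *ᵥ (R⁻¹ *ᵥ e) = e := by
    rw [Matrix.mulVec_mulVec, Matrix.mul_nonsing_inv _ hdet, Matrix.one_mulVec]
  have hue : u ⬝ᵥ e = u p := by simp [e]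
  have hee : (R⁻¹ *ᵥ e) ⬝ᵥ e = R⁻¹ p p := by simp [e]
  -- Up to the factor `R⁻¹ p p`, this vector is `u` minus its `R`-orthogonal projection onto `R⁻¹
  -- e`.
  have h := posSemidef_quadForm_nonneg hR.posSemidef (R⁻¹ p p • u + (-u p) • (R⁻¹ *ᵥ e))
  rw [quadForm_add hR.isHermitian] at h
  simp only [Matrix.mulVec_smul, hRe, smul_dotProduct, dotProduct_smul, smul_eq_mul, hee] at h
  rw [dotProduct_mulVec_comm hR.isHermitian (R⁻¹ *ᵥ e) u, hRe, hue] at h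
  have : 0 ≤ R⁻¹ p p * (R⁻¹ p p * (u ⬝ᵥ (R *ᵥ u)) - u p ^ 2) := by nlinarith
  linarith [nonneg_of_mul_nonneg_right this hpos]

/-- The gain solves the normal equation `(R + Bᵀ P B) L = Bᵀ P A`, so the terms linear in `u` are
absorbed by the square, and what is left over in `x` is the Riccati form. -/
theorem complete_square {P A Q : Matrix k k ℝ} {B : Matrix k l ℝ} {R : Matrix l l ℝ}
    (hP : P.PosSemidef) (hR : R.PosDef) (x : k → ℝ) (u : l → ℝ) :
    x ⬝ᵥ (Q *ᵥ x) + u ⬝ᵥ (R *ᵥ u) + (A *ᵥ x + B *ᵥ u) ⬝ᵥ (P *ᵥ (A *ᵥ x + B *ᵥ u))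
      = x ⬝ᵥ (riccatiOp P A B Q R *ᵥ x)
        + (u + gainOp P A B R *ᵥ x) ⬝ᵥ (gainWeight P B R *ᵥ (u + gainOp P A B R *ᵥ x)) := by
  have hΛ := gainWeight_posDef hP B hR
  have hdet : IsUnit (gainWeight P B R).det := (Matrix.isUnit_iff_isUnit_det _).1 hΛ.isUnit
  have hΛL : gainWeight P B R * gainOp P A B R = Bᵀ * P * A := by
    rw [gainOp, ← gainWeight]
    simp only [Matrix.mul_assoc]
    rw [Matrix.mul_nonsing_inv_cancel_left _ _ hdet]
  have hP' : Pᵀ = P := hP.isHermitian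
  have hlast : (gainOp P A B R *ᵥ x) ⬝ᵥ ((Bᵀ * P * A) *ᵥ x)
      = x ⬝ᵥ ((Aᵀ * P * B * (R + Bᵀ * P * B)⁻¹ * Bᵀ * P * A) *ᵥ x) := by
    rw [dotProduct_comm, mulVec_dotProduct_eq, Matrix.mulVec_mulVec]
    congr 2
    simp only [Matrix.transpose_mul, Matrix.transpose_transpose, hP', gainOp, Matrix.mul_assoc]
  rw [quadForm_add hP.isHermitian, quadForm_add hΛ.isHermitian,
    dotProduct_mulVec_comm hΛ.isHermitian (gainOp P A B R *ᵥ x) u,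
    Matrix.mulVec_mulVec x (gainWeight P B R), hΛL, hlast, riccatiOp,
    gainWeight, Matrix.sub_mulVec, Matrix.add_mulVec, Matrix.add_mulVec, dotProduct_sub,
    dotProduct_add, dotProduct_add]
  simp only [mulVec_dotProduct_eq, Matrix.mulVec_mulVec, Matrix.mul_assoc]
  ring

/-- The minimizing input `u = -L x` kills the completed square, so the Riccati form is then a
one-step cost, a sum of three nonnegative terms. -/
theorem riccatiOp_posSemidef {P Q : Matrix k k ℝ} (A : Matrix k k ℝ) (B : Matrix k l ℝ)
    {R : Matrix l l ℝ} (hP : P.PosSemidef) (hQ : Q.PosSemidef) (hR : R.PosDef) :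
    (riccatiOp P A B Q R).PosSemidef := by
  have hP' : Pᵀ = P := hP.isHermitian
  have hQ' : Qᵀ = Q := hQ.isHermitian
  have hΛ' : (R + Bᵀ * P * B)ᵀ = R + Bᵀ * P * B := (gainWeight_posDef hP B hR).isHermitian
  refine Matrix.PosSemidef.of_dotProduct_mulVec_nonneg ?_ fun x => ?_
  · change (riccatiOp P A B Q R)ᵀ = _
    simp only [riccatiOp, Matrix.transpose_sub, Matrix.transpose_add, Matrix.transpose_mul,
      Matrix.transpose_nonsing_inv, hP', hQ', Matrix.transpose_transpose, Matrix.mul_assoc]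
    have h : (Rᵀ + Bᵀ * (P * B)) = R + Bᵀ * (P * B) := by
      rw [show Rᵀ = R from hR.isHermitian]
    rw [h]
  · have h := complete_square (A := A) (Q := Q) (B := B) hP hR x (-(gainOp P A B R *ᵥ x))
    rw [neg_add_cancel, Matrix.mulVec_zero, dotProduct_zero, add_zero] at h
    rw [star_trivial, ← h]
    have h₁ := posSemidef_quadForm_nonneg hQ x
    have h₂ := posSemidef_quadForm_nonneg hR.posSemidef (-(gainOp P A B R *ᵥ x))
    have h₃ := posSemidef_quadForm_nonneg hP (A *ᵥ x + B *ᵥ -(gainOp P A B R *ᵥ x))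
    linarith

theorem riccatiToGo_posSemidef (A : Matrix k k ℝ) (B : Matrix k l ℝ) {Q QT : Matrix k k ℝ}
    {R : Matrix l l ℝ} (hQ : Q.PosSemidef) (hQT : QT.PosSemidef) (hR : R.PosDef) :
    ∀ j, (riccatiToGo A B Q QT R j).PosSemidef
  | 0 => hQT
  | j + 1 => riccatiOp_posSemidef A B (riccatiToGo_posSemidef A B hQ hQT hR j) hQ hR

/-- The expected cost of a linear system with quadratic costs, whose noise is orthogonal to the
current state and control, after completing squares. -/
theorem lq_cost_eq {Ω : Type*} {m₀ : MeasurableSpace Ω} {μ : Measure Ω}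
    {A Q QT : Matrix k k ℝ} {B : Matrix k l ℝ} {R : Matrix l l ℝ}
    (hQ : Q.PosSemidef) (hQT : QT.PosSemidef) (hR : R.PosDef) (N : ℕ)
    {x w : ℕ → Ω → k → ℝ} {u : ℕ → Ω → l → ℝ}
    (hx : ∀ t ≤ N, MemLp (x t) 2 μ) (hu : ∀ t < N, MemLp (u t) 2 μ)
    (hw : ∀ t < N, MemLp (w t) 2 μ)
    (hdyn : ∀ t < N, ∀ᵐ ω ∂μ, x (t + 1) ω = A *ᵥ x t ω + B *ᵥ u t ω + w t ω)
    (hwx : ∀ t < N, Orth μ (w t) (x t)) (hwu : ∀ t < N, Orth μ (w t) (u t)) :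
    ∑ t ∈ Finset.range N, ((∫ ω, x t ω ⬝ᵥ (Q *ᵥ x t ω) ∂μ) + ∫ ω, u t ω ⬝ᵥ (R *ᵥ u t ω) ∂μ)
        + ∫ ω, x N ω ⬝ᵥ (QT *ᵥ x N ω) ∂μ
      = (∫ ω, x 0 ω ⬝ᵥ (riccatiToGo A B Q QT R N *ᵥ x 0 ω) ∂μ)
        + ∑ t ∈ Finset.range N,
          ((∫ ω, w t ω ⬝ᵥ (riccatiToGo A B Q QT R (N - (t + 1)) *ᵥ w t ω) ∂μ)
          + ∫ ω, (u t ω + gainOp (riccatiToGo A B Q QT R (N - (t + 1))) A B R *ᵥ x t ω) ⬝ᵥ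
              (gainWeight (riccatiToGo A B Q QT R (N - (t + 1))) B R *ᵥ
                (u t ω + gainOp (riccatiToGo A B Q QT R (N - (t + 1))) A B R *ᵥ x t ω)) ∂μ) := by
  -- The expected value function along the trajectory. Each stage cost is a noise term plus a square
  -- minus the increment of `V`, and the increments telescope.
  set V : ℕ → ℝ := fun t => ∫ ω, x t ω ⬝ᵥ (riccatiToGo A B Q QT R (N - t) *ᵥ x t ω) ∂μ
    with hV
  have step : ∀ t ∈ Finset.range N,
      ((∫ ω, x t ω ⬝ᵥ (Q *ᵥ x t ω) ∂μ) + ∫ ω, u t ω ⬝ᵥ (R *ᵥ u t ω) ∂μ)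
      = ((∫ ω, w t ω ⬝ᵥ (riccatiToGo A B Q QT R (N - (t + 1)) *ᵥ w t ω) ∂μ)
          + ∫ ω, (u t ω + gainOp (riccatiToGo A B Q QT R (N - (t + 1))) A B R *ᵥ x t ω) ⬝ᵥ
              (gainWeight (riccatiToGo A B Q QT R (N - (t + 1))) B R *ᵥ
                (u t ω + gainOp (riccatiToGo A B Q QT R (N - (t + 1))) A B R *ᵥ x t ω)) ∂μ)
        - (V (t + 1) - V t) := by
    intro t ht
    have htN : t < N := Finset.mem_range.1 ht
    set P := riccatiToGo A B Q QT R (N - (t + 1)) with hPdef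
    have hP : P.PosSemidef := riccatiToGo_posSemidef A B hQ hQT hR _
    have hPt : riccatiToGo A B Q QT R (N - t) = riccatiOp P A B Q R := by
      rw [show N - t = (N - (t + 1)) + 1 by omega]; rfl
    have hxt := hx t htN.le
    have hut := hu t htN
    have hwt := hw t htN
    have hy : MemLp (fun ω => A *ᵥ x t ω + B *ᵥ u t ω) 2 μ :=
      (memLp_mulVec hxt A).add (memLp_mulVec hut B)
    have hs : MemLp (fun ω => u t ω + gainOp P A B R *ᵥ x t ω) 2 μ :=
      hut.add (memLp_mulVec hxt _)
    have horth : Orth μ (w t) fun ω => A *ᵥ x t ω + B *ᵥ u t ω :=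
      ((hwx t htN).mulVec_right hwt hxt A).add_right ((hwu t htN).mulVec_right hwt hut B) hwt
        (memLp_mulVec hxt A) (memLp_mulVec hut B)
    -- The noise is orthogonal to the predicted state, so it enters the next value only through its
    -- own quadratic form.
    have hnext : V (t + 1)
        = (∫ ω, (A *ᵥ x t ω + B *ᵥ u t ω) ⬝ᵥ (P *ᵥ (A *ᵥ x t ω + B *ᵥ u t ω)) ∂μ)
          + ∫ ω, w t ω ⬝ᵥ (P *ᵥ w t ω) ∂μ := by
      rw [← integral_quadForm_add hP.isHermitian hy hwt horth]
      refine integral_congr_ae ?_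
      filter_upwards [hdyn t htN] with ω hω
      rw [hω]
    have hsq : (∫ ω, x t ω ⬝ᵥ (Q *ᵥ x t ω) ∂μ) + (∫ ω, u t ω ⬝ᵥ (R *ᵥ u t ω) ∂μ)
        + (∫ ω, (A *ᵥ x t ω + B *ᵥ u t ω) ⬝ᵥ (P *ᵥ (A *ᵥ x t ω + B *ᵥ u t ω)) ∂μ)
        = V t + ∫ ω, (u t ω + gainOp P A B R *ᵥ x t ω) ⬝ᵥ (gainWeight P B R *ᵥ
                (u t ω + gainOp P A B R *ᵥ x t ω)) ∂μ := by
      have hxu : Integrable (fun ω => x t ω ⬝ᵥ (Q *ᵥ x t ω) + u t ω ⬝ᵥ (R *ᵥ u t ω)) μ :=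
        (integrable_dotProduct_mulVec hxt hxt Q).add (integrable_dotProduct_mulVec hut hut R)
      rw [← integral_add (integrable_dotProduct_mulVec hxt hxt Q)
        (integrable_dotProduct_mulVec hut hut R), ← integral_add hxu (integrable_dotProduct_mulVec hy hy P)]
      simp only [hV, hPt]
      rw [← integral_add (integrable_dotProduct_mulVec hxt hxt _)
        (integrable_dotProduct_mulVec hs hs _)]
      simp only [complete_square hP hR]
    rw [hnext]
    linarith
  rw [Finset.sum_congr rfl step, Finset.sum_sub_distrib, Finset.sum_range_sub]
  simp only [hV, Nat.sub_self, Nat.sub_zero, riccatiToGo]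
  ring

end Riccati

/-! ### Block structure -/

section Blocks

variable {n : ℕ} {d e : Agent n → ℕ}

@[simp] theorem blk_add (x y : Stacked d) (i : Agent n) : blk (x + y) i = blk x i + blk y i := rfl

@[simp] theorem blk_sub (x y : Stacked d) (i : Agent n) : blk (x - y) i = blk x i - blk y i := rfl

@[simp] theorem blk_zero (i : Agent n) : blk (0 : Stacked d) i = 0 := rfl

theorem stacked_ext {x y : Stacked d} (h : ∀ i, blk x i = blk y i) : x = y := by
  funext ⟨i, a⟩
  exact congrFun (h i) a

/-- The block `M_{i0}`. -/
def majorCol (M : BlockMatrix d e) (i : Agent n) : Matrix (Fin (d i)) (Fin (e none)) ℝ :=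
  M.submatrix (fun a => ⟨i, a⟩) (fun a => ⟨none, a⟩)

theorem blk_mulVec_none {M : BlockMatrix d e} (hM : ∀ p q, q.1 ≠ p.1 → q.1 ≠ none → M p q = 0)
    (x : Stacked e) : blk (M *ᵥ x) none = diagBlk M none *ᵥ blk x none := by
  funext a
  simp only [blk, Matrix.mulVec, dotProduct, Fintype.sum_sigma, diagBlk, Matrix.submatrix_apply]
  refine Finset.sum_eq_single none (fun j _ hj => ?_) (by simp)
  exact Finset.sum_eq_zero fun b _ => by rw [hM _ _ hj hj, zero_mul]

theorem blk_mulVec_some {M : BlockMatrix d e} (hM : ∀ p q, q.1 ≠ p.1 → q.1 ≠ none → M p q = 0)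
    (x : Stacked e) (i : Fin n) :
    blk (M *ᵥ x) (some i)
      = diagBlk M (some i) *ᵥ blk x (some i) + majorCol M (some i) *ᵥ blk x none := by
  funext a
  simp only [blk, Matrix.mulVec, dotProduct, Fintype.sum_sigma, diagBlk, Matrix.submatrix_apply,
    majorCol, Pi.add_apply, Fintype.sum_option]
  rw [add_comm]
  congr 1
  refine Finset.sum_eq_single i (fun j _ hj => ?_) (by simp)
  exact Finset.sum_eq_zero fun b _ => by rw [hM _ _ (by simpa using hj) (by simp), zero_mul]

theorem measurable_of_eval {Ω ι : Type*} {π : ι → Type*} {m : MeasurableSpace Ω}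
    [∀ i, MeasurableSpace (π i)] {f : Ω → ∀ i, π i} (h : ∀ i, Measurable fun ω => f ω i) :
    Measurable f :=
  measurable_pi_iff.2 h

theorem measurable_mulVec {k l : Type*} [Fintype k] [Fintype l] {Ω : Type*}
    {m : MeasurableSpace Ω} (M : Matrix k l ℝ) {f : Ω → l → ℝ} (hf : Measurable f) :
    Measurable fun ω => M *ᵥ f ω :=
  (Continuous.matrix_mulVec continuous_const continuous_id).measurable.comp hf

theorem measurable_stacked {Ω : Type*} {m : MeasurableSpace Ω} {f : Ω → Stacked d}
    (h : ∀ i, Measurable fun ω => blk (f ω) i) : Measurable f := by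
  refine measurable_pi_iff.2 fun p => ?_
  exact (measurable_pi_apply p.2).comp (h p.1)

theorem measurable_blk {Ω : Type*} {m : MeasurableSpace Ω} {f : Ω → Stacked d}
    (h : Measurable f) (i : Agent n) : Measurable fun ω => blk (f ω) i :=
  measurable_pi_iff.2 fun a => (measurable_pi_apply (⟨i, a⟩ : Σ i, Fin (d i))).comp h

end Blocks

/-! ### Driven states -/

section Driven

variable {n : ℕ} {S : System n} {Ω Ω' : Type*}

theorem blk_driven_none_succ (u : ℕ → Ω → Stacked S.du) (t : ℕ) (ω : Ω) :
    blk (driven S u (t + 1) ω) none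
      = diagBlk S.A none *ᵥ blk (driven S u t ω) none + diagBlk S.B none *ᵥ blk (u t ω) none := by
  rw [driven, blk_add, blk_mulVec_none S.A_sparse, blk_mulVec_none S.B_sparse]

theorem blk_driven_some_succ (u : ℕ → Ω → Stacked S.du) (i : Fin n) (t : ℕ) (ω : Ω) :
    blk (driven S u (t + 1) ω) (some i)
      = (diagBlk S.A (some i) *ᵥ blk (driven S u t ω) (some i)
          + majorCol S.A (some i) *ᵥ blk (driven S u t ω) none)
        + (diagBlk S.B (some i) *ᵥ blk (u t ω) (some i)
          + majorCol S.B (some i) *ᵥ blk (u t ω) none) := by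
  rw [driven, blk_add, blk_mulVec_some S.A_sparse, blk_mulVec_some S.B_sparse]

/-- The major block evolves autonomously under `u_0`. Two sample spaces are allowed because a
trajectory on `Ω` is later compared with one computed from a point of the information space. -/
theorem blk_driven_none_congr {u : ℕ → Ω → Stacked S.du} {u' : ℕ → Ω' → Stacked S.du} {ω : Ω}
    {ω' : Ω'} : ∀ {t : ℕ}, (∀ s < t, blk (u s ω) none = blk (u' s ω') none) →
      blk (driven S u t ω) none = blk (driven S u' t ω') none
  | 0, _ => rfl
  | t + 1, h => by
    rw [blk_driven_none_succ, blk_driven_none_succ, h t t.lt_succ_self,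
      blk_driven_none_congr (t := t) fun s hs => h s (by omega)]

theorem blk_driven_some_congr {u : ℕ → Ω → Stacked S.du} {u' : ℕ → Ω' → Stacked S.du} {ω : Ω}
    {ω' : Ω'} (i : Fin n) : ∀ {t : ℕ}, (∀ s < t, blk (u s ω) none = blk (u' s ω') none) →
      (∀ s < t, blk (u s ω) (some i) = blk (u' s ω') (some i)) →
      blk (driven S u t ω) (some i) = blk (driven S u' t ω') (some i)
  | 0, _, _ => rfl
  | t + 1, h, h' => by
    rw [blk_driven_some_succ, blk_driven_some_succ, h t t.lt_succ_self, h' t t.lt_succ_self,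
      blk_driven_none_congr (t := t) fun s hs => h s (by omega),
      blk_driven_some_congr i (t := t) (fun s hs => h s (by omega)) fun s hs => h' s (by omega)]

theorem driven_congr {u : ℕ → Ω → Stacked S.du} {u' : ℕ → Ω' → Stacked S.du} {ω : Ω} {ω' : Ω'} :
    ∀ {t : ℕ}, (∀ s < t, u s ω = u' s ω') → driven S u t ω = driven S u' t ω'
  | 0, _ => rfl
  | t + 1, h => by
    simp only [driven]
    rw [h t t.lt_succ_self, driven_congr (t := t) fun s hs => h s (by omega)]

theorem driven_add (u u' : ℕ → Ω → Stacked S.du) (ω : Ω) :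
    ∀ t, driven S (fun s ω => u s ω + u' s ω) t ω = driven S u t ω + driven S u' t ω
  | 0 => by simp [driven]
  | t + 1 => by
    simp only [driven, driven_add u u' ω t, Matrix.mulVec_add]
    abel

theorem measurable_blk_driven_none {m : MeasurableSpace Ω} {u : ℕ → Ω → Stacked S.du} :
    ∀ {t : ℕ}, (∀ s < t, Measurable fun ω => blk (u s ω) none) →
      Measurable fun ω => blk (driven S u t ω) none
  | 0, _ => (measurable_const : Measurable fun _ : Ω => (0 : Fin (S.dx none) → ℝ))
  | t + 1, h => by
    simp only [blk_driven_none_succ]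
    exact (measurable_mulVec _ (measurable_blk_driven_none fun s hs => h s (by omega))).add
      (measurable_mulVec _ (h t t.lt_succ_self))

theorem measurable_blk_driven_some {m : MeasurableSpace Ω} {u : ℕ → Ω → Stacked S.du}
    (i : Fin n) : ∀ {t : ℕ}, (∀ s < t, Measurable fun ω => blk (u s ω) none) →
      (∀ s < t, Measurable fun ω => blk (u s ω) (some i)) →
      Measurable fun ω => blk (driven S u t ω) (some i)
  | 0, _, _ => (measurable_const : Measurable fun _ : Ω => (0 : Fin (S.dx (some i)) → ℝ))
  | t + 1, h, h' => by
    simp only [blk_driven_some_succ]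
    exact ((measurable_mulVec _ (measurable_blk_driven_some i (fun s hs => h s (by omega))
      fun s hs => h' s (by omega))).add
      (measurable_mulVec _ (measurable_blk_driven_none fun s hs => h s (by omega)))).add
      ((measurable_mulVec _ (h' t t.lt_succ_self)).add (measurable_mulVec _ (h t t.lt_succ_self)))

theorem measurable_driven {m : MeasurableSpace Ω} {u : ℕ → Ω → Stacked S.du} {t : ℕ}
    (h : ∀ s < t, Measurable (u s)) : Measurable (driven S u t) := by
  induction t with
  | zero => exact measurable_const
  | succ t ih =>
    exact (measurable_mulVec _ (ih fun s hs => h s (by omega))).add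
      (measurable_mulVec _ (h t t.lt_succ_self))

theorem memLp_driven {m : MeasurableSpace Ω} {μ : Measure Ω} {u : ℕ → Ω → Stacked S.du}
    {t : ℕ} (h : ∀ s < t, MemLp (u s) 2 μ) : MemLp (driven S u t) 2 μ := by
  induction t with
  | zero => exact MemLp.zero'
  | succ t ih =>
    exact (memLp_mulVec (ih fun s hs => h s (by omega)) S.A).add
      (memLp_mulVec (h t t.lt_succ_self) S.B)

theorem integrable_mulVec {k l : Type*} [Fintype k] [Fintype l] {m : MeasurableSpace Ω}
    {μ : Measure Ω} {X : Ω → l → ℝ} (hX : Integrable X μ) (M : Matrix k l ℝ) :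
    Integrable (fun ω => M *ᵥ X ω) μ :=
  (LinearMap.toContinuousLinearMap (Matrix.mulVecLin M)).integrable_comp hX

theorem integrable_driven {m : MeasurableSpace Ω} {μ : Measure Ω} {u : ℕ → Ω → Stacked S.du}
    {t : ℕ} (h : ∀ s < t, Integrable (u s) μ) : Integrable (driven S u t) μ := by
  induction t with
  | zero => exact integrable_zero _ _ _
  | succ t ih =>
    exact (integrable_mulVec (ih fun s hs => h s (by omega)) S.A).add
      (integrable_mulVec (h t t.lt_succ_self) S.B)

/-- Superposition: the state is its control-free part plus the response to the inputs. -/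
theorem Primitives.stateOf_eq (ξ : Primitives S Ω) (us : ℕ → Stacked S.du) (ω : Ω) :
    ∀ t, ξ.stateOf us ω t = ξ.xsto t ω + driven S (fun s (_ : Ω) => us s) t ω
  | 0 => by simp [Primitives.stateOf, Primitives.xsto, driven]
  | t + 1 => by
    simp only [Primitives.stateOf, Primitives.xsto, driven, ξ.stateOf_eq us ω t, Matrix.mulVec_add]
    abel

theorem Strategy.state_eq (g : Strategy S) (ξ : Primitives S Ω) (t : ℕ) (ω : Ω) :
    g.state ξ t ω = ξ.xsto t ω + driven S (g.control ξ) t ω := by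
  rw [Strategy.state, ξ.stateOf_eq]
  congr 1
  exact driven_congr fun _ _ => rfl

end Driven

/-! ### Control-free information -/

section Info

variable {n : ℕ} {S : System n} {Ω : Type*}

/-- The information of the major agent if no control is applied. -/
def Primitives.freeMajor (ξ : Primitives S Ω) (t : ℕ) (ω : Ω) : InfoMajor S t :=
  (fun s => blk (ξ.xsto s ω) none, 0)

/-- The information of a minor agent if no control is applied. -/
def Primitives.freeMinor (ξ : Primitives S Ω) (i : Fin n) (t : ℕ) (ω : Ω) : InfoMinor S i t :=
  (ξ.freeMajor t ω, fun s => S.C i *ᵥ blk (ξ.xsto s ω) (some i) + ξ.v i s ω, 0)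

/-- The control inputs of the major agent recorded in its information. -/
def majorInput (t s : ℕ) (I : InfoMajor S t) : Stacked S.du
  | ⟨none, a⟩ => if h : s < t then I.2 ⟨s, h⟩ a else 0
  | ⟨some _, _⟩ => 0

/-- The control inputs recorded in the information of a minor agent. -/
def minorInput (i : Fin n) (t s : ℕ) (I : InfoMinor S i t) : Stacked S.du
  | ⟨none, a⟩ => if h : s < t then I.1.2 ⟨s, h⟩ a else 0
  | ⟨some j, a⟩ => if hj : j = i then if h : s < t then I.2.2 ⟨s, h⟩ (hj ▸ a) else 0 else 0

/-- Removes the effect of the controls from the information of the major agent. -/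
def freeOfMajor (t : ℕ) (I : InfoMajor S t) : InfoMajor S t :=
  (fun s => I.1 s - blk (driven S (majorInput t) s I) none, 0)

/-- Removes the effect of the controls from the information of a minor agent. -/
def freeOfMinor (i : Fin n) (t : ℕ) (I : InfoMinor S i t) : InfoMinor S i t :=
  (freeOfMajor t I.1,
    fun s => I.2.1 s - S.C i *ᵥ blk (driven S (minorInput i t) s I) (some i), 0)

theorem measurable_freeOfMajor (t : ℕ) : Measurable (freeOfMajor (S := S) t) := by
  have hin : ∀ s, Measurable fun I : InfoMajor S t => blk (majorInput t s I) none := by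
    intro s
    refine measurable_of_eval fun a => ?_
    simp only [blk, majorInput]
    split_ifs <;> fun_prop
  refine Measurable.prodMk (measurable_of_eval fun s => ?_) measurable_const
  exact ((measurable_pi_apply s).comp measurable_fst).sub
    (measurable_blk_driven_none fun r _ => hin r)

theorem measurable_freeOfMinor (i : Fin n) (t : ℕ) :
    Measurable (freeOfMinor (S := S) i t) := by
  have hin : ∀ s, Measurable fun I : InfoMinor S i t => blk (minorInput i t s I) none := by
    intro s
    refine measurable_of_eval fun a => ?_
    simp only [blk, minorInput]
    split_ifs <;> fun_prop
  have hin' : ∀ s, Measurable fun I : InfoMinor S i t => blk (minorInput i t s I) (some i) := by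
    intro s
    refine measurable_of_eval fun a => ?_
    simp only [blk, minorInput, dite_true]
    split_ifs <;> fun_prop
  refine Measurable.prodMk ((measurable_freeOfMajor t).comp measurable_fst)
    (Measurable.prodMk (measurable_of_eval fun s => ?_) measurable_const)
  exact ((measurable_pi_apply s).comp (measurable_fst.comp measurable_snd)).sub
    (measurable_mulVec _ (measurable_blk_driven_some i (fun r _ => hin r) fun r _ => hin' r))

/-- The response of `x_0` involves only past values of `u_0`, all recorded in `I_0(t)`, so it can be
recomputed and subtracted whatever the inputs were. -/
theorem Primitives.freeOfMajor_infoMajorOf (ξ : Primitives S Ω) (us : ℕ → Stacked S.du) (ω : Ω)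
    (t : ℕ) : freeOfMajor t (ξ.infoMajorOf us ω t) = ξ.freeMajor t ω := by
  refine Prod.ext (funext fun s => ?_) rfl
  change blk (ξ.stateOf us ω s) none - _ = blk (ξ.xsto s ω) none
  rw [ξ.stateOf_eq, blk_add, blk_driven_none_congr (ω' := ξ.infoMajorOf us ω t)
    (u' := majorInput t), add_sub_cancel_right]
  intro r hr
  funext a
  simp [blk, majorInput, Primitives.infoMajorOf, show r < t by omega]

/-- The response of `x_i` involves only past values of `u_0` and `u_i`, both recorded in `I_i(t)`;
the inputs of other minor agents never reach `x_i`. -/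
theorem Primitives.freeOfMinor_infoMinorOf (ξ : Primitives S Ω) (us : ℕ → Stacked S.du) (ω : Ω)
    (i : Fin n) (t : ℕ) : freeOfMinor i t (ξ.infoMinorOf us ω i t) = ξ.freeMinor i t ω := by
  refine Prod.ext (ξ.freeOfMajor_infoMajorOf us ω t) (Prod.ext (funext fun s => ?_) rfl)
  change S.C i *ᵥ blk (ξ.stateOf us ω s) (some i) + ξ.v i s ω - _
    = S.C i *ᵥ blk (ξ.xsto s ω) (some i) + ξ.v i s ω
  rw [ξ.stateOf_eq, blk_add, blk_driven_some_congr i (ω' := ξ.infoMinorOf us ω i t)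
    (u' := minorInput i t), Matrix.mulVec_add]
  · abel
  · intro r hr
    funext a
    simp [blk, minorInput, Primitives.infoMajorOf, Primitives.infoMinorOf, show r < t by omega]
  · intro r hr
    funext a
    simp [blk, minorInput, Primitives.infoMinorOf, show r < t by omega]

/-- The sigma-algebra generated by the control-free information of the major agent. -/
@[reducible] def Primitives.sigMajor (ξ : Primitives S Ω) (t : ℕ) : MeasurableSpace Ω :=
  MeasurableSpace.comap (ξ.freeMajor t) inferInstance

/-- The sigma-algebra generated by the control-free information of a minor agent. -/
@[reducible] def Primitives.sigMinor (ξ : Primitives S Ω) (i : Fin n) (t : ℕ) :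
    MeasurableSpace Ω :=
  MeasurableSpace.comap (ξ.freeMinor i t) inferInstance

theorem Primitives.measurable_xsto_none (ξ : Primitives S Ω) {s t : ℕ} (h : s ≤ t) :
    Measurable[ξ.sigMajor t] fun ω => blk (ξ.xsto s ω) none :=
  (measurable_pi_apply (⟨s, by omega⟩ : Fin (t + 1))).comp
    (measurable_fst.comp (comap_measurable (ξ.freeMajor t)))

theorem Primitives.measurable_free_output (ξ : Primitives S Ω) (i : Fin n) {s t : ℕ}
    (h : s ≤ t) : Measurable[ξ.sigMinor i t] fun ω =>
      S.C i *ᵥ blk (ξ.xsto s ω) (some i) + ξ.v i s ω :=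
  (measurable_pi_apply (⟨s, by omega⟩ : Fin (t + 1))).comp
    (measurable_fst.comp (measurable_snd.comp (comap_measurable (ξ.freeMinor i t))))

theorem Primitives.sigMajor_le_sigMinor (ξ : Primitives S Ω) (i : Fin n) (t : ℕ) :
    ξ.sigMajor t ≤ ξ.sigMinor i t :=
  measurable_iff_comap_le.1 (measurable_fst.comp (comap_measurable (ξ.freeMinor i t)))

theorem Primitives.sigMajor_mono (ξ : Primitives S Ω) : Monotone ξ.sigMajor := by
  intro s t hst
  refine measurable_iff_comap_le.1 (Measurable.prodMk (measurable_of_eval fun r => ?_)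
    measurable_const)
  exact ξ.measurable_xsto_none (by omega)

theorem Primitives.sigMinor_mono (ξ : Primitives S Ω) (i : Fin n) :
    Monotone (ξ.sigMinor i) := by
  intro s t hst
  refine measurable_iff_comap_le.1 (Measurable.prodMk ?_
    (Measurable.prodMk (measurable_of_eval fun r => ?_) measurable_const))
  · exact measurable_iff_comap_le.2 ((ξ.sigMajor_mono hst).trans (ξ.sigMajor_le_sigMinor i t))
  · exact ξ.measurable_free_output i (by omega)

theorem Strategy.blk_control_none (g : Strategy S) (ξ : Primitives S Ω) (t : ℕ) (ω : Ω) :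
    blk (g.control ξ t ω) none = g.major t (g.infoMajor ξ t ω) := by
  rw [g.control_eq]; rfl

theorem Strategy.blk_control_some (g : Strategy S) (ξ : Primitives S Ω) (i : Fin n) (t : ℕ)
    (ω : Ω) : blk (g.control ξ t ω) (some i) = g.minor i t (g.infoMinor ξ i t ω) := by
  rw [g.control_eq]; rfl

/-- Induction on time: earlier inputs are functions of earlier information, hence of control-free
information, and they alone separate `x_0` from its control-free version. -/
theorem Strategy.measurable_infoMajor (g : Strategy S) (ξ : Primitives S Ω) (t : ℕ) :
    Measurable[ξ.sigMajor t] (g.infoMajor ξ t) := by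
  induction t using Nat.strong_induction_on with
  | _ t ih =>
    have hu : ∀ s < t, Measurable[ξ.sigMajor t] fun ω => blk (g.control ξ s ω) none := by
      intro s hs
      simp only [g.blk_control_none]
      exact ((g.measurable_major s).comp (ih s hs)).mono (ξ.sigMajor_mono hs.le) le_rfl
    refine Measurable.prodMk (measurable_of_eval fun s => ?_)
      (measurable_of_eval fun s => hu s s.2)
    change Measurable[ξ.sigMajor t] fun ω => blk (g.state ξ s ω) none
    simp only [g.state_eq, blk_add]
    exact (ξ.measurable_xsto_none (by omega)).add
      (measurable_blk_driven_none fun r hr => hu r (by omega))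

theorem Strategy.measurable_control_none (g : Strategy S) (ξ : Primitives S Ω) (t : ℕ) :
    Measurable[ξ.sigMajor t] fun ω => blk (g.control ξ t ω) none := by
  simp only [g.blk_control_none]
  exact (g.measurable_major t).comp (g.measurable_infoMajor ξ t)

theorem Strategy.measurable_infoMinor (g : Strategy S) (ξ : Primitives S Ω) (i : Fin n) (t : ℕ) :
    Measurable[ξ.sigMinor i t] (g.infoMinor ξ i t) := by
  induction t using Nat.strong_induction_on with
  | _ t ih =>
    have hu : ∀ s < t, Measurable[ξ.sigMinor i t] fun ω => blk (g.control ξ s ω) (some i) := by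
      intro s hs
      simp only [g.blk_control_some]
      exact ((g.measurable_minor i s).comp (ih s hs)).mono (ξ.sigMinor_mono i hs.le) le_rfl
    have hu₀ : ∀ s < t, Measurable[ξ.sigMinor i t] fun ω => blk (g.control ξ s ω) none :=
      fun s hs => (g.measurable_control_none ξ s).mono
        ((ξ.sigMajor_mono hs.le).trans (ξ.sigMajor_le_sigMinor i t)) le_rfl
    refine Measurable.prodMk ((g.measurable_infoMajor ξ t).mono
      (ξ.sigMajor_le_sigMinor i t) le_rfl) (Measurable.prodMk
      (measurable_of_eval fun s => ?_) (measurable_of_eval fun s => hu s s.2))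
    change Measurable[ξ.sigMinor i t] fun ω =>
      S.C i *ᵥ blk (g.state ξ s ω) (some i) + ξ.v i s ω
    simp only [g.state_eq, blk_add, Matrix.mulVec_add, add_right_comm]
    exact (ξ.measurable_free_output i (by omega)).add (measurable_mulVec _
      (measurable_blk_driven_some i (fun r hr => hu₀ r (by omega)) fun r hr => hu r (by omega)))

theorem Strategy.measurable_control_some (g : Strategy S) (ξ : Primitives S Ω) (i : Fin n)
    (t : ℕ) : Measurable[ξ.sigMinor i t] fun ω => blk (g.control ξ t ω) (some i) := by
  simp only [g.blk_control_some]
  exact (g.measurable_minor i t).comp (g.measurable_infoMinor ξ i t)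

/-- The common information generates the same sigma-algebra under all strategies. -/
theorem Strategy.sigmaCom_eq (g : Strategy S) (ξ : Primitives S Ω) (t : ℕ) :
    g.sigmaCom ξ t = ξ.sigMajor t := by
  refine le_antisymm (measurable_iff_comap_le.1 (g.measurable_infoMajor ξ t)) ?_
  have h : ξ.freeMajor t = freeOfMajor t ∘ g.infoMajor ξ t :=
    funext fun ω => (ξ.freeOfMajor_infoMajorOf _ ω t).symm
  refine measurable_iff_comap_le.1 ?_
  rw [h]
  exact (measurable_freeOfMajor t).comp (comap_measurable _)

/-- The information of a minor agent generates the same sigma-algebra under all strategies. -/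
theorem Strategy.sigmaMinor_eq (g : Strategy S) (ξ : Primitives S Ω) (i : Fin n) (t : ℕ) :
    g.sigmaMinor ξ i t = ξ.sigMinor i t := by
  refine le_antisymm (measurable_iff_comap_le.1 (g.measurable_infoMinor ξ i t)) ?_
  have h : ξ.freeMinor i t = freeOfMinor i t ∘ g.infoMinor ξ i t :=
    funext fun ω => (ξ.freeOfMinor_infoMinorOf _ ω i t).symm
  refine measurable_iff_comap_le.1 ?_
  rw [h]
  exact (measurable_freeOfMinor i t).comp (comap_measurable _)

/-- Every adapted control process is generated by a strategy. -/
theorem Primitives.exists_strategy (ξ : Primitives S Ω) (u : ℕ → Ω → Stacked S.du)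
    (h₀ : ∀ t, Measurable[ξ.sigMajor t] fun ω => blk (u t ω) none)
    (h : ∀ i t, Measurable[ξ.sigMinor i t] fun ω => blk (u t ω) (some i)) :
    ∃ g : Strategy S, ∀ t, g.control ξ t = u t := by
  -- The process factors through the control-free information. Composing the factor with
  -- `freeOfMajor` or `freeOfMinor` gives control laws that reproduce the process whatever inputs
  -- came before, so the closed loop needs no induction.
  choose f hfm hf using fun t => (h₀ t).exists_eq_measurable_comp
  choose f' hfm' hf' using fun i t => (h i t).exists_eq_measurable_comp
  refine ⟨⟨fun t => f t ∘ freeOfMajor t, fun i t => f' i t ∘ freeOfMinor i t,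
    fun t => (hfm t).comp (measurable_freeOfMajor t),
    fun i t => (hfm' i t).comp (measurable_freeOfMinor i t)⟩, fun t => funext fun ω => ?_⟩
  refine stacked_ext fun j => ?_
  cases j with
  | none =>
    rw [Strategy.blk_control_none]
    exact (congrArg (f t) (ξ.freeOfMajor_infoMajorOf _ ω t)).trans (congrFun (hf t) ω).symm
  | some i =>
    rw [Strategy.blk_control_some]
    exact (congrArg (f' i t) (ξ.freeOfMinor_infoMinorOf _ ω i t)).trans
      (congrFun (hf' i t) ω).symm

end Info

/-! ### Sigma-algebras generated by primitive random variables -/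

section Sig

variable {n : ℕ} {S : System n} {Ω : Type*}

/-- The sigma-algebra generated by the primitive random variables with labels in `K`. -/
@[reducible] def Primitives.sig (ξ : Primitives S Ω) (K : Set (PrimIdx n S.N)) :
    MeasurableSpace Ω :=
  ⨆ p ∈ K, MeasurableSpace.comap (ξ.fam p) inferInstance

theorem Primitives.sig_mono (ξ : Primitives S Ω) {K L : Set (PrimIdx n S.N)} (h : K ⊆ L) :
    ξ.sig K ≤ ξ.sig L :=
  biSup_mono h

theorem Primitives.sig_union (ξ : Primitives S Ω) (K L : Set (PrimIdx n S.N)) :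
    ξ.sig (K ∪ L) = ξ.sig K ⊔ ξ.sig L :=
  iSup_union

theorem Primitives.measurable_fam (ξ : Primitives S Ω) {K : Set (PrimIdx n S.N)}
    {p : PrimIdx n S.N} (hp : p ∈ K) : Measurable[ξ.sig K] (ξ.fam p) :=
  measurable_iff_comap_le.2
    (le_biSup (fun p => MeasurableSpace.comap (ξ.fam p) inferInstance) hp)

/-- Labels of the primitive random variables that determine the common information. -/
def majorIdx (n N t : ℕ) : Set (PrimIdx n N) := fun p =>
  match p with
  | .init j => j = none
  | .process j s => j = none ∧ (s : ℕ) < t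
  | .obs _ _ => False

/-- Labels of the primitive random variables that drive minor agent `i`. -/
def ownIdx {n : ℕ} (N : ℕ) (i : Fin n) (t : ℕ) : Set (PrimIdx n N) := fun p =>
  match p with
  | .init j => j = some i
  | .process j s => j = some i ∧ (s : ℕ) < t
  | .obs _ _ => False

/-- Labels of the primitive random variables that determine the information of agent `i`. -/
def minorIdx {n : ℕ} (N : ℕ) (i : Fin n) (t : ℕ) : Set (PrimIdx n N) := fun p =>
  match p with
  | .init j => j = none ∨ j = some i
  | .process j s => (j = none ∨ j = some i) ∧ (s : ℕ) < t
  | .obs j s => j = i ∧ (s : ℕ) ≤ t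

theorem majorIdx_mono (n N : ℕ) : Monotone (majorIdx n N) := by
  rintro s t hst (j | ⟨j, r⟩ | ⟨j, r⟩) hp
  · exact hp
  · exact ⟨hp.1, hp.2.trans_le hst⟩
  · exact hp

theorem majorIdx_subset_minorIdx {N : ℕ} (i : Fin n) (t : ℕ) :
    majorIdx n N t ⊆ minorIdx N i t := by
  rintro (j | ⟨j, r⟩ | ⟨j, r⟩) hp
  · exact Or.inl hp
  · exact ⟨Or.inl hp.1, hp.2⟩
  · exact hp.elim

theorem ownIdx_subset_minorIdx {N : ℕ} (i : Fin n) (t : ℕ) : ownIdx N i t ⊆ minorIdx N i t := by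
  rintro (j | ⟨j, r⟩ | ⟨j, r⟩) hp
  · exact Or.inr hp
  · exact ⟨Or.inr hp.1, hp.2⟩
  · exact hp.elim

theorem ownIdx_mono {N : ℕ} (i : Fin n) : Monotone (ownIdx N i) := by
  rintro s t hst (j | ⟨j, r⟩ | ⟨j, r⟩) hp
  · exact hp
  · exact ⟨hp.1, hp.2.trans_le hst⟩
  · exact hp

/-- Used with `Primitives.Standard.condExp_sig`: common information arriving after time `s` is
irrelevant for estimating what agent `i` can know at time `s`. -/
theorem majorIdx_inter_minorIdx {N : ℕ} (i : Fin n) {s t : ℕ} (hst : s ≤ t) :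
    majorIdx n N t ∩ minorIdx N i s = majorIdx n N s := by
  refine Set.Subset.antisymm ?_ (Set.subset_inter (majorIdx_mono n N hst)
    (majorIdx_subset_minorIdx i s))
  rintro (j | ⟨j, r⟩ | ⟨j, r⟩) ⟨hp, hp'⟩
  · exact hp
  · exact ⟨hp.1, hp'.2⟩
  · exact hp

/-- The combinatorial source of the conditional independence of two minor agents given the common
information. -/
theorem minorIdx_inter_minorIdx {N : ℕ} {i j : Fin n} (hij : i ≠ j) (t : ℕ) :
    minorIdx N i t ∩ minorIdx N j t = majorIdx n N t := by
  refine Set.Subset.antisymm ?_ (Set.subset_inter (majorIdx_subset_minorIdx i t)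
    (majorIdx_subset_minorIdx j t))
  have key : ∀ a : Agent n, (a = none ∨ a = some i) → (a = none ∨ a = some j) → a = none := by
    rintro a (h | h) (h' | h')
    · exact h
    · exact h
    · exact h'
    · exact absurd (Option.some.inj (h.symm.trans h')) hij
  rintro (a | ⟨a, r⟩ | ⟨a, r⟩) ⟨hp, hp'⟩
  · exact key a hp hp'
  · exact ⟨key a hp.1 hp'.1, hp.2⟩
  · exact absurd (hp.1.symm.trans hp'.1) hij

theorem disjoint_ownIdx_majorIdx {N : ℕ} (i : Fin n) (t : ℕ) :
    Disjoint (ownIdx N i t) (majorIdx n N t) := by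
  rw [Set.disjoint_left]
  rintro (a | ⟨a, r⟩ | ⟨a, r⟩) hp hp'
  · exact absurd ((show a = some i from hp).symm.trans hp') (by simp)
  · exact absurd (hp.1.symm.trans hp'.1) (by simp)
  · exact hp

theorem disjoint_process_majorIdx {N : ℕ} (j : Agent n) (t : Fin (N + 1)) :
    Disjoint {PrimIdx.process j t} (majorIdx n N t) := by
  rw [Set.disjoint_singleton_left]
  exact fun h => lt_irrefl _ h.2

theorem disjoint_process_minorIdx {N : ℕ} (j : Agent n) (i : Fin n) (t : Fin (N + 1)) :
    Disjoint {PrimIdx.process j t} (minorIdx N i t) := by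
  rw [Set.disjoint_singleton_left]
  exact fun h => lt_irrefl _ h.2

variable {m₀ : MeasurableSpace Ω} {μ : Measure Ω} {ξ : Primitives S Ω}

theorem Primitives.Standard.sig_le (hξ : ξ.Standard μ) (K : Set (PrimIdx n S.N)) :
    ξ.sig K ≤ m₀ :=
  iSup₂_le fun p _ => measurable_iff_comap_le.1 (hξ.measurable p)

theorem Primitives.Standard.indep_sig (hξ : ξ.Standard μ) {K L : Set (PrimIdx n S.N)}
    (h : Disjoint K L) : Indep (ξ.sig K) (ξ.sig L) μ :=
  indep_iSup_of_disjoint (fun p => measurable_iff_comap_le.1 (hξ.measurable p))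
    hξ.indep.iIndep h

/-- Variables with labels in `L \ K` are independent of everything generated by `K`, so they can be
dropped from the conditioning. -/
theorem Primitives.Standard.condExp_sig [IsProbabilityMeasure μ] (hξ : ξ.Standard μ) {E : Type*}
    [NormedAddCommGroup E] [NormedSpace ℝ E] [CompleteSpace E] {K : Set (PrimIdx n S.N)}
    (L : Set (PrimIdx n S.N)) {X : Ω → E} (hX : StronglyMeasurable[ξ.sig K] X) :
    μ[X | ξ.sig L] =ᵐ[μ] μ[X | ξ.sig (L ∩ K)] := by
  have h : ξ.sig L = ξ.sig (L ∩ K) ⊔ ξ.sig (L \ K) := by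
    rw [← ξ.sig_union, Set.inter_union_sdiff]
  rw [h]
  exact condExp_sup_of_indep (hξ.sig_le K) (hξ.sig_le _) (ξ.sig_mono Set.inter_subset_right)
    (hξ.indep_sig Set.disjoint_sdiff_right) hX

end Sig

/-! ### Noise driven by the major agent and by the minor agents -/

section Noise

variable {n : ℕ} {S : System n} {Ω : Type*}

/-- The stacked vector with all blocks but that of the major agent set to zero. -/
def majorPart {d : Agent n → ℕ} (x : Stacked d) : Stacked d
  | ⟨none, a⟩ => x ⟨none, a⟩
  | ⟨some _, _⟩ => 0

@[simp] theorem blk_majorPart_none {d : Agent n → ℕ} (x : Stacked d) :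
    blk (majorPart x) none = blk x none := rfl

@[simp] theorem blk_majorPart_some {d : Agent n → ℕ} (x : Stacked d) (i : Fin n) :
    blk (majorPart x) (some i) = 0 := rfl

/-- The part of the control-free state that is caused by the noise of the major agent. -/
def Primitives.mean (ξ : Primitives S Ω) : ℕ → Ω → Stacked S.dx
  | 0 => fun ω => majorPart (ξ.x1vec ω)
  | t + 1 => fun ω => S.A *ᵥ ξ.mean t ω + majorPart (ξ.wvec t ω)

/-- The part of the control-free state that is caused by the noise of the minor agents. -/
def Primitives.own (ξ : Primitives S Ω) (t : ℕ) (ω : Ω) : Stacked S.dx :=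
  ξ.xsto t ω - ξ.mean t ω

/-- Noise of the minor agents never reaches the major agent. Consequently the `own` parts of
different minor agents evolve without any coupling. -/
theorem Primitives.blk_own_none (ξ : Primitives S Ω) (ω : Ω) :
    ∀ t, blk (ξ.own t ω) none = 0
  | 0 => by simp [Primitives.own, Primitives.xsto, Primitives.mean]
  | t + 1 => by
    have h := ξ.blk_own_none ω t
    rw [Primitives.own, blk_sub, sub_eq_zero] at h
    simp [Primitives.own, Primitives.xsto, Primitives.mean, blk_mulVec_none S.A_sparse, h]

theorem Primitives.blk_own_some_zero (ξ : Primitives S Ω) (ω : Ω) (i : Fin n) :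
    blk (ξ.own 0 ω) (some i) = ξ.x1 (some i) ω := by
  simp [Primitives.own, Primitives.xsto, Primitives.mean]
  rfl

theorem Primitives.blk_own_some_succ (ξ : Primitives S Ω) (ω : Ω) (i : Fin n) (t : ℕ) :
    blk (ξ.own (t + 1) ω) (some i)
      = diagBlk S.A (some i) *ᵥ blk (ξ.own t ω) (some i) + ξ.w (some i) t ω := by
  have h := ξ.blk_own_none ω t
  rw [Primitives.own, blk_sub, sub_eq_zero] at h
  simp only [Primitives.own, Primitives.xsto, Primitives.mean, blk_sub, blk_add,
    blk_mulVec_some S.A_sparse, h, blk_majorPart_some, Matrix.mulVec_sub]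
  rw [show blk (ξ.wvec t ω) (some i) = ξ.w (some i) t ω from rfl]
  abel

theorem Primitives.measurable_mean (ξ : Primitives S Ω) {t : ℕ} (ht : t ≤ S.N) :
    Measurable[ξ.sig (majorIdx n S.N t)] (ξ.mean t) := by
  have hpart : ∀ {m : MeasurableSpace Ω} {f : Ω → Stacked S.dx},
      (Measurable[m] fun ω => blk (f ω) none) → Measurable[m] fun ω => majorPart (f ω) := by
    intro m f hf
    refine measurable_stacked fun i => ?_
    cases i with
    | none => exact hf
    | some i => exact (measurable_const : Measurable[m] fun _ => (0 : Fin _ → ℝ))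
  induction t with
  | zero => exact hpart (ξ.measurable_fam (p := .init none) rfl)
  | succ t ih =>
    refine Measurable.add (measurable_mulVec _ ((ih (by omega)).mono
      (ξ.sig_mono (majorIdx_mono n S.N (Nat.le_succ t))) le_rfl)) (hpart ?_)
    exact ξ.measurable_fam (p := .process none ⟨t, by omega⟩) ⟨rfl, Nat.lt_succ_self t⟩

theorem Primitives.measurable_own (ξ : Primitives S Ω) (i : Fin n) {t : ℕ} (ht : t ≤ S.N) :
    Measurable[ξ.sig (ownIdx S.N i t)] fun ω => blk (ξ.own t ω) (some i) := by
  induction t with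
  | zero =>
    simp only [ξ.blk_own_some_zero]
    exact ξ.measurable_fam (p := .init (some i)) rfl
  | succ t ih =>
    simp only [ξ.blk_own_some_succ]
    refine Measurable.add (measurable_mulVec _ ((ih (by omega)).mono
      (ξ.sig_mono (ownIdx_mono i (Nat.le_succ t))) le_rfl)) ?_
    exact ξ.measurable_fam (p := .process (some i) ⟨t, by omega⟩) ⟨rfl, Nat.lt_succ_self t⟩

theorem Primitives.xsto_eq (ξ : Primitives S Ω) (t : ℕ) (ω : Ω) :
    ξ.xsto t ω = ξ.mean t ω + ξ.own t ω := by
  rw [Primitives.own, add_sub_cancel]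

theorem Primitives.blk_xsto_none_succ (ξ : Primitives S Ω) (t : ℕ) (ω : Ω) :
    blk (ξ.xsto (t + 1) ω) none = diagBlk S.A none *ᵥ blk (ξ.xsto t ω) none + ξ.w none t ω := by
  rw [Primitives.xsto, blk_add, blk_mulVec_none S.A_sparse]
  rfl

/-- The state `x_0` is observed without noise, so its increments reveal the process noise of the
major agent. The bound on `t` is there because labels exist only within the horizon. -/
theorem Primitives.sigMajor_eq (ξ : Primitives S Ω) {t : ℕ} (ht : t ≤ S.N) :
    ξ.sigMajor t = ξ.sig (majorIdx n S.N t) := by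
  apply le_antisymm
  · refine measurable_iff_comap_le.1 (Measurable.prodMk (measurable_of_eval fun s => ?_)
      measurable_const)
    simp only [ξ.xsto_eq, blk_add, ξ.blk_own_none, add_zero]
    exact (measurable_blk (ξ.measurable_mean (by omega)) none).mono
      (ξ.sig_mono (majorIdx_mono n S.N (by omega))) le_rfl
  · refine iSup₂_le fun p hp => measurable_iff_comap_le.1 ?_
    match p, hp with
    | .init j, hp =>
      obtain rfl : j = none := hp
      exact ξ.measurable_xsto_none (Nat.zero_le t)
    | .process j s, hp =>
      obtain ⟨rfl, hs⟩ := hp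
      have h : ξ.fam (.process none s) = fun ω =>
          blk (ξ.xsto (s + 1) ω) none - diagBlk S.A none *ᵥ blk (ξ.xsto s ω) none := by
        funext ω
        rw [ξ.blk_xsto_none_succ, add_sub_cancel_left]
        rfl
      rw [h]
      exact (ξ.measurable_xsto_none (by omega)).sub
        (measurable_mulVec _ (ξ.measurable_xsto_none hs.le))
    | .obs _ _, hp => exact hp.elim

/-- An inclusion is enough here: noisy outputs need not determine the underlying noise, and the
larger sigma-algebra serves only to locate variables among the labels. -/
theorem Primitives.sigMinor_le (ξ : Primitives S Ω) (i : Fin n) {t : ℕ} (ht : t ≤ S.N) :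
    ξ.sigMinor i t ≤ ξ.sig (minorIdx S.N i t) := by
  refine measurable_iff_comap_le.1 (Measurable.prodMk ?_
    (Measurable.prodMk (measurable_of_eval fun s => ?_) measurable_const))
  · refine measurable_iff_comap_le.2 ?_
    exact (ξ.sigMajor_eq ht).le.trans (ξ.sig_mono (majorIdx_subset_minorIdx i t))
  · refine Measurable.add (measurable_mulVec _ ?_) ?_
    · simp only [ξ.xsto_eq, blk_add]
      refine Measurable.add ?_ ?_
      · exact (measurable_blk (ξ.measurable_mean (by omega)) _).mono (ξ.sig_mono
          ((majorIdx_mono n S.N (by omega)).trans (majorIdx_subset_minorIdx i t))) le_rfl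
      · exact (ξ.measurable_own i (by omega)).mono (ξ.sig_mono
          ((ownIdx_mono i (by omega)).trans (ownIdx_subset_minorIdx i t))) le_rfl
    · exact ξ.measurable_fam (p := .obs i ⟨s, by omega⟩) ⟨rfl, Nat.lt_succ_iff.1 s.2⟩

variable {m₀ : MeasurableSpace Ω} {μ : Measure Ω} {ξ : Primitives S Ω}

theorem Primitives.Standard.memLp_w (hξ : ξ.Standard μ) (j : Agent n) {t : ℕ} (ht : t ≤ S.N) :
    MemLp (ξ.w j t) 2 μ :=
  hξ.memLp (.process j ⟨t, by omega⟩)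

theorem memLp_stacked {d : Agent n → ℕ} {X : Ω → Stacked d}
    (h : ∀ i, MemLp (fun ω => blk (X ω) i) 2 μ) : MemLp X 2 μ :=
  MemLp.of_eval fun p => (h p.1).eval p.2

theorem memLp_blk {d : Agent n → ℕ} {X : Ω → Stacked d} (h : MemLp X 2 μ) (i : Agent n) :
    MemLp (fun ω => blk (X ω) i) 2 μ :=
  MemLp.of_eval fun a => h.eval (⟨i, a⟩ : Σ i, Fin (d i))

theorem memLp_majorPart {d : Agent n → ℕ} {X : Ω → Stacked d}
    (h : MemLp (fun ω => blk (X ω) none) 2 μ) : MemLp (fun ω => majorPart (X ω)) 2 μ := by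
  refine memLp_stacked fun i => ?_
  cases i with
  | none => exact h
  | some i => exact MemLp.zero'

theorem Primitives.Standard.memLp_mean (hξ : ξ.Standard μ) {t : ℕ} (ht : t ≤ S.N) :
    MemLp (ξ.mean t) 2 μ := by
  induction t with
  | zero => exact memLp_majorPart (X := ξ.x1vec) (hξ.memLp (.init none))
  | succ t ih =>
    have h₁ : MemLp (fun ω => S.A *ᵥ ξ.mean t ω) 2 μ := memLp_mulVec (ih (by omega)) S.A
    have h₂ : MemLp (fun ω => majorPart (ξ.wvec t ω)) 2 μ :=
      memLp_majorPart (X := ξ.wvec t) (hξ.memLp_w none (by omega))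
    exact h₁.add h₂

theorem Primitives.Standard.memLp_own_some (hξ : ξ.Standard μ) (i : Fin n) {t : ℕ}
    (ht : t ≤ S.N) : MemLp (fun ω => blk (ξ.own t ω) (some i)) 2 μ := by
  induction t with
  | zero =>
    simp only [ξ.blk_own_some_zero]
    exact hξ.memLp (.init (some i))
  | succ t ih =>
    simp only [ξ.blk_own_some_succ]
    exact (memLp_mulVec (ih (by omega)) (diagBlk S.A (some i))).add
      (hξ.memLp_w (some i) (by omega))

theorem Primitives.Standard.memLp_own (hξ : ξ.Standard μ) {t : ℕ} (ht : t ≤ S.N) :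
    MemLp (ξ.own t) 2 μ := by
  refine memLp_stacked fun i => ?_
  cases i with
  | none =>
    simp only [ξ.blk_own_none]
    exact MemLp.zero'
  | some i => exact hξ.memLp_own_some i ht

theorem Primitives.Standard.integral_own [IsProbabilityMeasure μ] (hξ : ξ.Standard μ)
    (i : Fin n) {t : ℕ} (ht : t ≤ S.N) : ∫ ω, blk (ξ.own t ω) (some i) ∂μ = 0 := by
  induction t with
  | zero =>
    simp only [ξ.blk_own_some_zero]
    exact hξ.mean_zero (.init (some i))
  | succ t ih =>
    have hi := (hξ.memLp_own_some i (show t ≤ S.N by omega)).integrable one_le_two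
    simp only [ξ.blk_own_some_succ]
    rw [integral_add (integrable_mulVec hi _)
      ((hξ.memLp_w (some i) (by omega)).integrable one_le_two),
      show ∫ ω, ξ.w (some i) t ω ∂μ = 0 from hξ.mean_zero (.process (some i) ⟨t, by omega⟩),
      add_zero]
    refine ((LinearMap.toContinuousLinearMap (Matrix.mulVecLin
      (diagBlk S.A (some i)))).integral_comp_comm hi).trans ?_
    rw [ih (by omega), map_zero]

end Noise

/-! ### Common and local parts of a random vector -/

section Split

variable {n : ℕ} {S : System n} {Ω : Type*} {m₀ : MeasurableSpace Ω} {μ : Measure Ω}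
  {ξ : Primitives S Ω} {d : Agent n → ℕ}

theorem integrable_blk {X : Ω → Stacked d} (h : Integrable X μ) (i : Agent n) :
    Integrable (fun ω => blk (X ω) i) μ :=
  Integrable.of_eval fun a => h.eval (⟨i, a⟩ : Σ i, Fin (d i))

theorem condExp_blk {m : MeasurableSpace Ω} {X : Ω → Stacked d} (hX : Integrable X μ)
    (i : Agent n) : (fun ω => blk ((μ[X | m]) ω) i) =ᵐ[μ] μ[fun ω => blk (X ω) i | m] :=
  (ContinuousLinearMap.pi fun a : Fin (d i) =>
    ContinuousLinearMap.proj (R := ℝ) (φ := fun _ : Σ i, Fin (d i) => ℝ) ⟨i, a⟩).comp_condExp_comm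
      hX

theorem condExp_stacked_eq_zero {m : MeasurableSpace Ω} {X : Ω → Stacked d}
    (hX : Integrable X μ) (h : ∀ i, μ[fun ω => blk (X ω) i | m] =ᵐ[μ] 0) :
    μ[X | m] =ᵐ[μ] 0 := by
  filter_upwards [ae_all_iff.2 h, ae_all_iff.2 fun i => condExp_blk (m := m) hX i] with ω h₁ h₂
  exact stacked_ext fun i => (h₂ i).trans (h₁ i)

theorem condExp_blk_eq_zero {m : MeasurableSpace Ω} {X : Ω → Stacked d} (hX : Integrable X μ)
    (h : μ[X | m] =ᵐ[μ] 0) (i : Agent n) : μ[fun ω => blk (X ω) i | m] =ᵐ[μ] 0 := by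
  filter_upwards [h, condExp_blk (m := m) hX i] with ω h₁ h₂
  rw [← h₂, h₁]
  rfl

/-- The block `M_{ij}`. -/
def offBlk {d e : Agent n → ℕ} (M : BlockMatrix d e) (i j : Agent n) :
    Matrix (Fin (d i)) (Fin (e j)) ℝ :=
  M.submatrix (fun a => ⟨i, a⟩) (fun a => ⟨j, a⟩)

theorem quadForm_eq_sum_blk (M : BlockMatrix d d) {x : Stacked d} (hx : blk x none = 0) :
    x ⬝ᵥ (M *ᵥ x)
      = ∑ i : Fin n, ∑ j : Fin n, blk x (some i) ⬝ᵥ (offBlk M (some i) (some j) *ᵥ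
          blk x (some j)) := by
  have h0 : ∀ a, x ⟨none, a⟩ = 0 := fun a => congrFun hx a
  simp only [dotProduct, Matrix.mulVec, Fintype.sum_sigma, Fintype.sum_option, h0, zero_mul,
    mul_zero, Finset.sum_const_zero, zero_add, blk, offBlk, Matrix.submatrix_apply,
    Finset.mul_sum]
  refine Finset.sum_congr rfl fun i _ => ?_
  rw [Finset.sum_comm]

/-- `C` is determined by the common information at time `t`, and the blocks of `E` are
determined by the primitive random variables behind the information of the respective agents,
and centered given the common information. -/
structure IsSplit (ξ : Primitives S Ω) (μ : Measure Ω) (t : ℕ) (C E : Ω → Stacked d) :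
    Prop where
  memLp_com : MemLp C 2 μ
  memLp_loc : MemLp E 2 μ
  measurable_com : Measurable[ξ.sig (majorIdx n S.N t)] C
  measurable_loc : ∀ i : Fin n, Measurable[ξ.sig (minorIdx S.N i t)] fun ω => blk (E ω) (some i)
  condExp_loc : μ[E | ξ.sig (majorIdx n S.N t)] =ᵐ[μ] 0
  loc_none : ∀ᵐ ω ∂μ, blk (E ω) none = 0

variable [IsProbabilityMeasure μ] {t : ℕ} {C E : Ω → Stacked d}

theorem IsSplit.orth_loc_com (h : IsSplit ξ μ t C E) (hξ : ξ.Standard μ) : Orth μ E C :=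
  orth_of_condExp_eq_zero (hξ.sig_le _) h.memLp_loc h.memLp_com h.condExp_loc
    h.measurable_com.stronglyMeasurable

/-- Given all the primitive variables of agent `j`, only the major ones matter for the block of
agent `i`, and given those it is centered. -/
theorem IsSplit.orth_loc_loc (h : IsSplit ξ μ t C E) (hξ : ξ.Standard μ) {i j : Fin n}
    (hij : i ≠ j) :
    Orth μ (fun ω => blk (E ω) (some i)) fun ω => blk (E ω) (some j) := by
  refine orth_of_condExp_eq_zero (hξ.sig_le (minorIdx S.N j t)) (memLp_blk h.memLp_loc _)
    (memLp_blk h.memLp_loc _) ?_ (h.measurable_loc j).stronglyMeasurable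
  refine (hξ.condExp_sig _ (h.measurable_loc i).stronglyMeasurable).trans ?_
  rw [minorIdx_inter_minorIdx hij.symm]
  exact condExp_blk_eq_zero (h.memLp_loc.integrable one_le_two) h.condExp_loc _

/-- The expectation of a quadratic form separates into a common and local parts. -/
theorem IsSplit.integral_quadForm (h : IsSplit ξ μ t C E) (hξ : ξ.Standard μ)
    {M : BlockMatrix d d} (hM : M.IsHermitian) :
    ∫ ω, (C ω + E ω) ⬝ᵥ (M *ᵥ (C ω + E ω)) ∂μ
      = (∫ ω, C ω ⬝ᵥ (M *ᵥ C ω) ∂μ)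
        + ∑ i : Fin n, ∫ ω, blk (E ω) (some i) ⬝ᵥ (diagBlk M (some i) *ᵥ blk (E ω) (some i)) ∂μ
        := by
  have hint : ∀ i j : Fin n, Integrable (fun ω => blk (E ω) (some i) ⬝ᵥ
      (offBlk M (some i) (some j) *ᵥ blk (E ω) (some j))) μ := fun i j =>
    integrable_dotProduct_mulVec (memLp_blk h.memLp_loc _) (memLp_blk h.memLp_loc _) _
  rw [integral_quadForm_add hM h.memLp_com h.memLp_loc (h.orth_loc_com hξ)]
  congr 1
  rw [integral_congr_ae (h.loc_none.mono fun ω hω => quadForm_eq_sum_blk M hω),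
    integral_finsetSum _ fun i _ => integrable_finsetSum _ fun j _ => hint i j]
  refine Finset.sum_congr rfl fun i _ => ?_
  rw [integral_finsetSum _ fun j _ => hint i j]
  refine Finset.sum_eq_single i (fun j _ hji => ?_) (by simp)
  exact ((h.orth_loc_loc hξ hji.symm).mulVec_right (memLp_blk h.memLp_loc _)
    (memLp_blk h.memLp_loc _) _).integral_dotProduct (memLp_blk h.memLp_loc _)
    (memLp_mulVec (memLp_blk h.memLp_loc _) _)

end Split

/-! ### The split of controls and states -/

section StateSplit

variable {n : ℕ} {S : System n} {Ω : Type*} {m₀ : MeasurableSpace Ω} {μ : Measure Ω}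
  {ξ : Primitives S Ω}

/-- The common part of the state. -/
noncomputable def Strategy.cstate (g : Strategy S) (ξ : Primitives S Ω) (μ : Measure Ω) (t : ℕ) (ω : Ω) :
    Stacked S.dx :=
  g.xcom ξ μ t ω + ξ.mean t ω

/-- The local part of the state. -/
noncomputable def Strategy.lstate (g : Strategy S) (ξ : Primitives S Ω) (μ : Measure Ω) (t : ℕ) (ω : Ω) :
    Stacked S.dx :=
  g.xloc ξ μ t ω + ξ.own t ω

theorem Strategy.control_split (g : Strategy S) (ξ : Primitives S Ω) (μ : Measure Ω) (t : ℕ)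
    (ω : Ω) : g.control ξ t ω = g.ucom ξ μ t ω + g.uloc ξ μ t ω := by
  rw [Strategy.uloc, add_sub_cancel]

theorem Strategy.state_split (g : Strategy S) (ξ : Primitives S Ω) (μ : Measure Ω) (t : ℕ)
    (ω : Ω) : g.state ξ t ω = g.cstate ξ μ t ω + g.lstate ξ μ t ω := by
  have h : driven S (g.control ξ) t ω = g.xcom ξ μ t ω + g.xloc ξ μ t ω := by
    rw [Strategy.xcom, Strategy.xloc, ← driven_add]
    exact driven_congr fun s _ => g.control_split ξ μ s ω
  rw [g.state_eq, h, ξ.xsto_eq, Strategy.cstate, Strategy.lstate]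
  abel

theorem Strategy.measurable_ucom (g : Strategy S) (ξ : Primitives S Ω) (μ : Measure Ω)
    (t : ℕ) : Measurable[ξ.sigMajor t] (g.ucom ξ μ t) := by
  rw [← g.sigmaCom_eq ξ t]
  exact stronglyMeasurable_condExp.measurable

theorem Strategy.measurable_uloc (g : Strategy S) (ξ : Primitives S Ω) (μ : Measure Ω)
    (i : Fin n) (t : ℕ) :
    Measurable[ξ.sigMinor i t] fun ω => blk (g.uloc ξ μ t ω) (some i) :=
  (g.measurable_control_some ξ i t).sub
    ((measurable_blk (g.measurable_ucom ξ μ t) _).mono (ξ.sigMajor_le_sigMinor i t) le_rfl)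

theorem Strategy.measurable_uloc_none (g : Strategy S) (ξ : Primitives S Ω) (μ : Measure Ω)
    (t : ℕ) : Measurable[ξ.sigMajor t] fun ω => blk (g.uloc ξ μ t ω) none :=
  (g.measurable_control_none ξ t).sub (measurable_blk (g.measurable_ucom ξ μ t) _)

theorem Strategy.measurable_xcom (g : Strategy S) (ξ : Primitives S Ω) (μ : Measure Ω)
    (t : ℕ) : Measurable[ξ.sigMajor t] (g.xcom ξ μ t) :=
  measurable_driven fun s hs => (g.measurable_ucom ξ μ s).mono (ξ.sigMajor_mono hs.le) le_rfl

theorem Strategy.measurable_xloc (g : Strategy S) (ξ : Primitives S Ω) (μ : Measure Ω)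
    (i : Fin n) (t : ℕ) :
    Measurable[ξ.sigMinor i t] fun ω => blk (g.xloc ξ μ t ω) (some i) :=
  measurable_blk_driven_some i
    (fun s hs => (g.measurable_uloc_none ξ μ s).mono
      ((ξ.sigMajor_mono hs.le).trans (ξ.sigMajor_le_sigMinor i t)) le_rfl)
    fun s hs => (g.measurable_uloc ξ μ i s).mono (ξ.sigMinor_mono i hs.le) le_rfl

theorem Primitives.Standard.sigMajor_le (hξ : ξ.Standard μ) {t : ℕ} (ht : t ≤ S.N) :
    ξ.sigMajor t ≤ m₀ :=
  (ξ.sigMajor_eq ht).le.trans (hξ.sig_le _)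

theorem Primitives.Standard.sigMinor_le (hξ : ξ.Standard μ) (i : Fin n) {t : ℕ} (ht : t ≤ S.N) :
    ξ.sigMinor i t ≤ m₀ :=
  (ξ.sigMinor_le i ht).trans (hξ.sig_le _)

theorem Strategy.measurable_control (g : Strategy S) (hξ : ξ.Standard μ) {t : ℕ}
    (ht : t ≤ S.N) : Measurable (g.control ξ t) := by
  refine measurable_stacked fun i => ?_
  cases i with
  | none => exact (g.measurable_control_none ξ t).mono (hξ.sigMajor_le ht) le_rfl
  | some i => exact (g.measurable_control_some ξ i t).mono (hξ.sigMinor_le i ht) le_rfl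

theorem Strategy.integrable_uloc (g : Strategy S) {t : ℕ}
    (hu : Integrable (g.control ξ t) μ) : Integrable (g.uloc ξ μ t) μ :=
  hu.sub integrable_condExp

theorem Strategy.memLp_ucom (g : Strategy S) {t : ℕ} (hu : MemLp (g.control ξ t) 2 μ) :
    MemLp (g.ucom ξ μ t) 2 μ :=
  hu.condExp one_le_two

theorem Strategy.memLp_uloc (g : Strategy S) {t : ℕ} (hu : MemLp (g.control ξ t) 2 μ) :
    MemLp (g.uloc ξ μ t) 2 μ :=
  hu.sub (g.memLp_ucom hu)

variable [IsProbabilityMeasure μ]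

/-- The input of the major agent is a function of the common information, so it equals its own
conditional expectation. -/
theorem Strategy.uloc_none (g : Strategy S) (hξ : ξ.Standard μ) {t : ℕ} (ht : t ≤ S.N)
    (hu : Integrable (g.control ξ t) μ) : ∀ᵐ ω ∂μ, blk (g.uloc ξ μ t ω) none = 0 := by
  have h := condExp_blk (m := g.sigmaCom ξ t) hu none
  rw [g.sigmaCom_eq ξ t, condExp_of_stronglyMeasurable (hξ.sigMajor_le ht)
    (g.measurable_control_none ξ t).stronglyMeasurable (integrable_blk hu _)] at h
  filter_upwards [h] with ω hω
  rw [Strategy.uloc, blk_sub, Strategy.ucom, g.sigmaCom_eq ξ t, hω, sub_self]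

theorem Strategy.condExp_uloc_self (g : Strategy S) (hξ : ξ.Standard μ) {t : ℕ}
    (ht : t ≤ S.N) (hu : Integrable (g.control ξ t) μ) :
    μ[g.uloc ξ μ t | ξ.sigMajor t] =ᵐ[μ] 0 := by
  have h₁ := condExp_sub (m := ξ.sigMajor t) hu
    (integrable_condExp : Integrable (g.ucom ξ μ t) μ)
  have h₂ := condExp_of_stronglyMeasurable (μ := μ) (hξ.sigMajor_le ht)
    (g.measurable_ucom ξ μ t).stronglyMeasurable integrable_condExp
  refine h₁.trans ?_
  rw [Strategy.ucom, g.sigmaCom_eq ξ t] at h₂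
  rw [g.sigmaCom_eq ξ t, h₂, sub_self]

/-- Common information gained between `s` and `t` is major noise, independent of what agent `i` knew
at time `s`; so centering at time `s` persists. -/
theorem Strategy.condExp_uloc (g : Strategy S) (hξ : ξ.Standard μ) {s t : ℕ} (hst : s ≤ t)
    (ht : t ≤ S.N) (hu : Integrable (g.control ξ s) μ) :
    μ[g.uloc ξ μ s | ξ.sigMajor t] =ᵐ[μ] 0 := by
  have hi := g.integrable_uloc hu
  refine condExp_stacked_eq_zero hi fun i => ?_
  cases i with
  | none =>
    refine (condExp_congr_ae (g.uloc_none hξ (hst.trans ht) hu)).trans ?_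
    rw [condExp_const (hξ.sigMajor_le ht)]
    rfl
  | some i =>
    rw [ξ.sigMajor_eq ht]
    refine (hξ.condExp_sig _ ((g.measurable_uloc ξ μ i s).mono (ξ.sigMinor_le i (hst.trans ht))
      le_rfl).stronglyMeasurable).trans ?_
    rw [majorIdx_inter_minorIdx i hst, ← ξ.sigMajor_eq (hst.trans ht)]
    exact condExp_blk_eq_zero hi (g.condExp_uloc_self hξ (hst.trans ht) hu) _

theorem Strategy.condExp_xloc (g : Strategy S) (hξ : ξ.Standard μ) {t : ℕ} (ht : t ≤ S.N)
    (hu : ∀ s < t, Integrable (g.control ξ s) μ) :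
    μ[g.xloc ξ μ t | ξ.sigMajor t] =ᵐ[μ] 0 := by
  -- The conditioning time stays fixed while the state time increases, so that the linear recursion
  -- passes through the conditional expectation.
  have key : ∀ r ≤ t, μ[g.xloc ξ μ r | ξ.sigMajor t] =ᵐ[μ] 0 := by
    intro r
    induction r with
    | zero =>
      intro _
      rw [show g.xloc ξ μ 0 = fun _ => 0 from rfl, condExp_const (hξ.sigMajor_le ht)]
      rfl
    | succ r ih =>
      intro hr
      have hx : Integrable (g.xloc ξ μ r) μ :=
        integrable_driven fun s hs => g.integrable_uloc (hu s (by omega))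
      have hv : Integrable (g.uloc ξ μ r) μ := g.integrable_uloc (hu r (by omega))
      refine (condExp_add (integrable_mulVec hx S.A) (integrable_mulVec hv S.B) _).trans ?_
      filter_upwards [condExp_mulVec (m := ξ.sigMajor t) hx S.A,
        condExp_mulVec (m := ξ.sigMajor t) hv S.B, ih (by omega),
        g.condExp_uloc hξ (by omega) ht (hu r (by omega))] with ω h₁ h₂ h₃ h₄
      rw [Pi.add_apply, ← h₁, ← h₂, h₃, h₄]
      simp
  exact key t le_rfl

theorem Primitives.Standard.condExp_own (hξ : ξ.Standard μ) {t : ℕ} (ht : t ≤ S.N) :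
    μ[ξ.own t | ξ.sigMajor t] =ᵐ[μ] 0 := by
  refine condExp_stacked_eq_zero ((hξ.memLp_own ht).integrable one_le_two) fun i => ?_
  cases i with
  | none =>
    simp only [ξ.blk_own_none]
    rw [condExp_const (hξ.sigMajor_le ht)]
    rfl
  | some i =>
    rw [ξ.sigMajor_eq ht]
    refine (condExp_indep_eq (hξ.sig_le _) (hξ.sig_le _)
      (ξ.measurable_own i ht).stronglyMeasurable
      (hξ.indep_sig (disjoint_ownIdx_majorIdx i t))).trans ?_
    rw [hξ.integral_own i ht]
    rfl

theorem Strategy.xloc_none (g : Strategy S) (hξ : ξ.Standard μ) {t : ℕ} (ht : t ≤ S.N)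
    (hu : ∀ s < t, Integrable (g.control ξ s) μ) :
    ∀ᵐ ω ∂μ, blk (g.xloc ξ μ t ω) none = 0 := by
  have h : ∀ᵐ ω ∂μ, ∀ s : Fin t, blk (g.uloc ξ μ s ω) none = 0 :=
    ae_all_iff.2 fun s => g.uloc_none hξ (by omega) (hu s s.2)
  filter_upwards [h] with ω hω
  have h0 : ∀ r, blk (driven S (fun _ (_ : Ω) => (0 : Stacked S.du)) r ω) none = 0 := by
    intro r
    induction r with
    | zero => rfl
    | succ r ih => simp [blk_driven_none_succ, ih]
  rw [← h0 t]
  exact blk_driven_none_congr fun s hs => hω ⟨s, hs⟩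

theorem Strategy.isSplit_control (g : Strategy S) (hξ : ξ.Standard μ) {t : ℕ} (ht : t ≤ S.N)
    (hu : MemLp (g.control ξ t) 2 μ) : IsSplit ξ μ t (g.ucom ξ μ t) (g.uloc ξ μ t) where
  memLp_com := g.memLp_ucom hu
  memLp_loc := g.memLp_uloc hu
  measurable_com := ξ.sigMajor_eq ht ▸ g.measurable_ucom ξ μ t
  measurable_loc i := (g.measurable_uloc ξ μ i t).mono (ξ.sigMinor_le i ht) le_rfl
  condExp_loc := ξ.sigMajor_eq ht ▸ g.condExp_uloc_self hξ ht (hu.integrable one_le_two)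
  loc_none := g.uloc_none hξ ht (hu.integrable one_le_two)

theorem Strategy.isSplit_state (g : Strategy S) (hξ : ξ.Standard μ) {t : ℕ} (ht : t ≤ S.N)
    (hu : ∀ s < t, MemLp (g.control ξ s) 2 μ) :
    IsSplit ξ μ t (g.cstate ξ μ t) (g.lstate ξ μ t) where
  memLp_com := (memLp_driven fun s hs => g.memLp_ucom (hu s hs)).add (hξ.memLp_mean ht)
  memLp_loc := (memLp_driven fun s hs => g.memLp_uloc (hu s hs)).add (hξ.memLp_own ht)
  measurable_com := by
    refine Measurable.add ?_ (ξ.measurable_mean ht)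
    rw [← ξ.sigMajor_eq ht]
    exact g.measurable_xcom ξ μ t
  measurable_loc i :=
    ((g.measurable_xloc ξ μ i t).mono (ξ.sigMinor_le i ht) le_rfl).add
      ((ξ.measurable_own i ht).mono (ξ.sig_mono (ownIdx_subset_minorIdx i t)) le_rfl)
  condExp_loc := by
    rw [← ξ.sigMajor_eq ht]
    have hui : ∀ s < t, Integrable (g.control ξ s) μ := fun s hs =>
      (hu s hs).integrable one_le_two
    refine (condExp_add (integrable_driven fun s hs => g.integrable_uloc (hui s hs))
      ((hξ.memLp_own ht).integrable one_le_two) _).trans ?_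
    filter_upwards [g.condExp_xloc hξ ht hui, hξ.condExp_own ht] with ω h₁ h₂
    rw [Pi.add_apply, h₂, show (μ[driven S (g.uloc ξ μ) t | ξ.sigMajor t]) ω = 0 from h₁]
    simp
  loc_none := by
    filter_upwards [g.xloc_none hξ ht fun s hs => (hu s hs).integrable one_le_two] with ω hω
    rw [Strategy.lstate, blk_add, hω, ξ.blk_own_none, add_zero]

/-- The estimate of the common state is the common part of the state. -/
theorem Strategy.zhatCom_eq (g : Strategy S) (hξ : ξ.Standard μ) {t : ℕ} (ht : t ≤ S.N)
    (hu : ∀ s < t, MemLp (g.control ξ s) 2 μ) : g.zhatCom ξ μ t =ᵐ[μ] g.cstate ξ μ t := by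
  have hs := g.isSplit_state hξ ht hu
  have hz : g.zcom ξ μ t = g.cstate ξ μ t + ξ.own t := by
    funext ω
    simp only [Strategy.zcom, Strategy.cstate, Pi.add_apply, ξ.xsto_eq]
    abel
  rw [Strategy.zhatCom, g.sigmaCom_eq, hz]
  refine (condExp_add (hs.memLp_com.integrable one_le_two)
    ((hξ.memLp_own ht).integrable one_le_two) _).trans ?_
  rw [condExp_of_stronglyMeasurable (hξ.sigMajor_le ht)
    (ξ.sigMajor_eq ht ▸ hs.measurable_com).stronglyMeasurable (hs.memLp_com.integrable one_le_two)]
  filter_upwards [hξ.condExp_own ht] with ω hω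
  rw [Pi.add_apply, hω, Pi.zero_apply, add_zero]

/-- The estimate of the noise of a minor agent from its information. -/
noncomputable def Primitives.ownHat (ξ : Primitives S Ω) (μ : Measure Ω) (i : Fin n) (t : ℕ) :
    Ω → Fin (S.dx (some i)) → ℝ :=
  μ[fun ω => blk (ξ.own t ω) (some i) | ξ.sigMinor i t]

/-- Both conditional expectations contain the `mean` part, which cancels. The controlled part is
known to agent `i`, and it and the `own` part are centered given the common information. -/
theorem Strategy.zhatLoc_eq (g : Strategy S) (hξ : ξ.Standard μ) (i : Fin n) {t : ℕ}
    (ht : t ≤ S.N) (hu : ∀ s < t, MemLp (g.control ξ s) 2 μ) :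
    ∀ᵐ ω ∂μ, g.zhatLoc ξ μ i t ω
      = blk (g.xloc ξ μ t ω) (some i) + ξ.ownHat μ i t ω := by
  have hui : ∀ s < t, Integrable (g.control ξ s) μ := fun s hs =>
    (hu s hs).integrable one_le_two
  have hxi : Integrable (g.xloc ξ μ t) μ :=
    integrable_driven fun s hs => g.integrable_uloc (hui s hs)
  have hoi : Integrable (ξ.own t) μ := (hξ.memLp_own ht).integrable one_le_two
  have hmi : Integrable (ξ.mean t) μ := (hξ.memLp_mean ht).integrable one_le_two
  have hz : g.zloc ξ μ i t = (fun ω => blk (g.xloc ξ μ t ω) (some i))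
      + (fun ω => blk (ξ.own t ω) (some i)) + fun ω => blk (ξ.mean t ω) (some i) := by
    funext ω
    simp only [Strategy.zloc, Pi.add_apply, ξ.xsto_eq, blk_add]
    abel
  have hmm : StronglyMeasurable[ξ.sigMajor t] fun ω => blk (ξ.mean t ω) (some i) := by
    rw [ξ.sigMajor_eq ht]
    exact (measurable_blk (ξ.measurable_mean ht) _).stronglyMeasurable
  have h₁ := condExp_add (m := ξ.sigMinor i t)
    ((integrable_blk hxi (some i)).add (integrable_blk hoi (some i))) (integrable_blk hmi (some i))
  have h₂ := condExp_add (m := ξ.sigMinor i t)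
    (integrable_blk hxi (some i)) (integrable_blk hoi (some i))
  have h₃ := condExp_add (m := ξ.sigMajor t)
    ((integrable_blk hxi (some i)).add (integrable_blk hoi (some i))) (integrable_blk hmi (some i))
  have h₄ := condExp_add (m := ξ.sigMajor t)
    (integrable_blk hxi (some i)) (integrable_blk hoi (some i))
  rw [condExp_of_stronglyMeasurable (hξ.sigMinor_le i ht)
    (g.measurable_xloc ξ μ i t).stronglyMeasurable (integrable_blk hxi _)] at h₂
  rw [condExp_of_stronglyMeasurable (hξ.sigMinor_le i ht)
    (hmm.mono (ξ.sigMajor_le_sigMinor i t)) (integrable_blk hmi _)] at h₁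
  rw [condExp_of_stronglyMeasurable (hξ.sigMajor_le ht) hmm (integrable_blk hmi _)] at h₃
  filter_upwards [h₁, h₂, h₃, h₄, condExp_blk_eq_zero hxi (g.condExp_xloc hξ ht hui) (some i),
    condExp_blk_eq_zero hoi (hξ.condExp_own ht) (some i)] with ω h₁ h₂ h₃ h₄ h₅ h₆
  rw [Strategy.zhatLoc, g.sigmaMinor_eq, g.sigmaCom_eq, hz, Pi.sub_apply, h₁, h₃, Pi.add_apply,
    Pi.add_apply, h₂, h₄, Pi.add_apply, Pi.add_apply, h₅, h₆, Primitives.ownHat]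
  simp

end StateSplit

/-! ### The cost as a constant plus squares -/

section Cost

variable {n : ℕ} {S : System n} {Ω : Type*} {m₀ : MeasurableSpace Ω} {μ : Measure Ω}
  {ξ : Primitives S Ω}

/-- The weight of the completed square of the common part. -/
noncomputable def System.Wcom (S : System n) (t : ℕ) : BlockMatrix S.du S.du :=
  gainWeight (S.Scom (t + 1)) S.B S.R

/-- The weight of the completed square of minor agent `i`. -/
noncomputable def System.Wloc (S : System n) (i : Fin n) (t : ℕ) :
    Matrix (Fin (S.du (some i))) (Fin (S.du (some i))) ℝ :=
  gainWeight (S.Sloc i (t + 1)) (diagBlk S.B (some i)) (diagBlk S.R (some i))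

theorem diagBlk_posSemidef {d : Agent n → ℕ} {M : BlockMatrix d d} (h : M.PosSemidef)
    (i : Agent n) : (diagBlk M i).PosSemidef :=
  h.submatrix _

theorem diagBlk_posDef {d : Agent n → ℕ} {M : BlockMatrix d d} (h : M.PosDef) (i : Agent n) :
    (diagBlk M i).PosDef :=
  h.submatrix fun _ _ hab => by simpa using hab

theorem System.Wcom_posDef (S : System n) (t : ℕ) : (S.Wcom t).PosDef :=
  gainWeight_posDef (riccatiToGo_posSemidef _ _ S.Q_psd S.QT_psd S.R_pd _) _ S.R_pd

theorem System.Wloc_posDef (S : System n) (i : Fin n) (t : ℕ) : (S.Wloc i t).PosDef :=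
  gainWeight_posDef (riccatiToGo_posSemidef _ _ (diagBlk_posSemidef S.Q_psd _)
    (diagBlk_posSemidef S.QT_psd _) (diagBlk_posDef S.R_pd _) _) _ (diagBlk_posDef S.R_pd _)

/-- The deviation of the common control from the optimal feedback. -/
noncomputable def Strategy.devCom (g : Strategy S) (ξ : Primitives S Ω) (μ : Measure Ω) (t : ℕ)
    (ω : Ω) : Stacked S.du :=
  g.ucom ξ μ t ω + S.Lcom t *ᵥ g.cstate ξ μ t ω

/-- The deviation of the local control of minor agent `i` from the optimal feedback. -/
noncomputable def Strategy.devLoc (g : Strategy S) (ξ : Primitives S Ω) (μ : Measure Ω)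
    (i : Fin n) (t : ℕ) (ω : Ω) : Fin (S.du (some i)) → ℝ :=
  blk (g.uloc ξ μ t ω) (some i)
    + S.Lloc i t *ᵥ (blk (g.xloc ξ μ t ω) (some i) + ξ.ownHat μ i t ω)

/-- The estimation error of minor agent `i`, weighted with its gain. -/
noncomputable def Primitives.errLoc (ξ : Primitives S Ω) (μ : Measure Ω) (i : Fin n) (t : ℕ)
    (ω : Ω) : Fin (S.du (some i)) → ℝ :=
  S.Lloc i t *ᵥ (blk (ξ.own t ω) (some i) - ξ.ownHat μ i t ω)

/-- The part of the expected cost that no strategy can influence. -/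
noncomputable def Primitives.baseCost (ξ : Primitives S Ω) (μ : Measure Ω) : ℝ :=
  ((∫ ω, ξ.mean 0 ω ⬝ᵥ (S.Scom 0 *ᵥ ξ.mean 0 ω) ∂μ)
    + ∑ t ∈ Finset.range S.N, ∫ ω, majorPart (ξ.wvec t ω) ⬝ᵥ
        (S.Scom (t + 1) *ᵥ majorPart (ξ.wvec t ω)) ∂μ)
  + ∑ i : Fin n, ((∫ ω, blk (ξ.own 0 ω) (some i) ⬝ᵥ
        (S.Sloc i 0 *ᵥ blk (ξ.own 0 ω) (some i)) ∂μ)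
    + ∑ t ∈ Finset.range S.N, ((∫ ω, ξ.w (some i) t ω ⬝ᵥ
        (S.Sloc i (t + 1) *ᵥ ξ.w (some i) t ω) ∂μ)
      + ∫ ω, ξ.errLoc μ i t ω ⬝ᵥ (S.Wloc i t *ᵥ ξ.errLoc μ i t ω) ∂μ))

theorem Strategy.cstate_succ (g : Strategy S) (ξ : Primitives S Ω) (μ : Measure Ω) (t : ℕ)
    (ω : Ω) : g.cstate ξ μ (t + 1) ω
      = S.A *ᵥ g.cstate ξ μ t ω + S.B *ᵥ g.ucom ξ μ t ω + majorPart (ξ.wvec t ω) := by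
  simp only [Strategy.cstate, Strategy.xcom, driven, Primitives.mean, Matrix.mulVec_add]
  abel

theorem Strategy.cstate_zero (g : Strategy S) (ξ : Primitives S Ω) (μ : Measure Ω) (ω : Ω) :
    g.cstate ξ μ 0 ω = ξ.mean 0 ω := by
  simp [Strategy.cstate, Strategy.xcom, driven]

theorem Strategy.lstate_zero (g : Strategy S) (ξ : Primitives S Ω) (μ : Measure Ω) (ω : Ω) :
    g.lstate ξ μ 0 ω = ξ.own 0 ω := by
  simp [Strategy.lstate, Strategy.xloc, driven]

theorem Primitives.Standard.memLp_ownHat (hξ : ξ.Standard μ) (i : Fin n) {t : ℕ}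
    (ht : t ≤ S.N) : MemLp (ξ.ownHat μ i t) 2 μ :=
  (hξ.memLp_own_some i ht).condExp one_le_two

theorem Strategy.memLp_xloc (g : Strategy S) {t : ℕ} (ht : t ≤ S.N)
    (hu : ∀ s < S.N, MemLp (g.control ξ s) 2 μ) : MemLp (g.xloc ξ μ t) 2 μ :=
  memLp_driven fun s hs => g.memLp_uloc (hu s (hs.trans_le ht))

theorem Primitives.Standard.memLp_errLoc (hξ : ξ.Standard μ) (i : Fin n) {t : ℕ}
    (ht : t ≤ S.N) : MemLp (ξ.errLoc μ i t) 2 μ :=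
  memLp_mulVec ((hξ.memLp_own_some i ht).sub (hξ.memLp_ownHat i ht)) (S.Lloc i t)

theorem Strategy.memLp_devLoc (g : Strategy S) (hξ : ξ.Standard μ) (i : Fin n) {t : ℕ}
    (ht : t < S.N) (hu : ∀ s < S.N, MemLp (g.control ξ s) 2 μ) :
    MemLp (g.devLoc ξ μ i t) 2 μ :=
  (memLp_blk (g.memLp_uloc (hu t ht)) (some i)).add (memLp_mulVec
    ((memLp_blk (g.memLp_xloc ht.le hu) (some i)).add (hξ.memLp_ownHat i ht.le)) (S.Lloc i t))

variable [IsProbabilityMeasure μ]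

/-- The coupling blocks `A_{i0}` and `B_{i0}` act on major local parts, which vanish, though only
almost surely. -/
theorem Strategy.lstate_succ (g : Strategy S) (hξ : ξ.Standard μ) (i : Fin n) {t : ℕ}
    (ht : t < S.N) (hu : ∀ s < S.N, Integrable (g.control ξ s) μ) :
    ∀ᵐ ω ∂μ, blk (g.lstate ξ μ (t + 1) ω) (some i)
      = diagBlk S.A (some i) *ᵥ blk (g.lstate ξ μ t ω) (some i)
        + diagBlk S.B (some i) *ᵥ blk (g.uloc ξ μ t ω) (some i) + ξ.w (some i) t ω := by
  filter_upwards [g.xloc_none hξ ht.le fun s hs => hu s (hs.trans ht),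
    g.uloc_none hξ ht.le (hu t ht)] with ω h₁ h₂
  rw [Strategy.xloc] at h₁
  simp only [Strategy.lstate, Strategy.xloc, blk_add, blk_driven_some_succ, h₁, h₂,
    ξ.blk_own_some_succ, Matrix.mulVec_add, Matrix.mulVec_zero, add_zero]
  abel

theorem Primitives.measurable_ownHat (ξ : Primitives S Ω) (μ : Measure Ω) (i : Fin n) (t : ℕ) :
    Measurable[ξ.sigMinor i t] (ξ.ownHat μ i t) :=
  stronglyMeasurable_condExp.measurable

theorem Primitives.Standard.condExp_errLoc (hξ : ξ.Standard μ) (i : Fin n) {t : ℕ}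
    (ht : t ≤ S.N) : μ[ξ.errLoc μ i t | ξ.sigMinor i t] =ᵐ[μ] 0 := by
  have ho := (hξ.memLp_own_some i ht).integrable one_le_two
  have hh := (hξ.memLp_ownHat i ht).integrable one_le_two
  have hd : Integrable (fun ω => blk (ξ.own t ω) (some i) - ξ.ownHat μ i t ω) μ := ho.sub hh
  refine (condExp_mulVec (m := ξ.sigMinor i t) hd (S.Lloc i t)).symm.trans ?_
  have h₁ := condExp_sub (m := ξ.sigMinor i t) ho hh
  rw [condExp_of_stronglyMeasurable (hξ.sigMinor_le i ht)
    (ξ.measurable_ownHat μ i t).stronglyMeasurable hh] at h₁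
  filter_upwards [h₁] with ω h₁
  have h₂ : (μ[fun ω => blk (ξ.own t ω) (some i) - ξ.ownHat μ i t ω | ξ.sigMinor i t]) ω = 0 :=
    h₁.trans (by simp [Primitives.ownHat])
  rw [h₂, Matrix.mulVec_zero]
  rfl

theorem Strategy.memLp_devCom (g : Strategy S) (hξ : ξ.Standard μ) {t : ℕ} (ht : t < S.N)
    (hu : ∀ s < S.N, MemLp (g.control ξ s) 2 μ) : MemLp (g.devCom ξ μ t) 2 μ :=
  (g.memLp_ucom (hu t ht)).add (memLp_mulVec
    (g.isSplit_state hξ ht.le fun s hs => hu s (hs.trans ht)).memLp_com (S.Lcom t))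

/-- Separation of estimation and control: replacing the local state by its estimate splits off an
error that is centered given `I_i(t)`, hence orthogonal to the deviation, which is a function of
`I_i(t)`. The error term does not involve the strategy. -/
theorem Strategy.integral_local_square (g : Strategy S) (hξ : ξ.Standard μ) (i : Fin n) {t : ℕ}
    (ht : t < S.N) (hu : ∀ s < S.N, MemLp (g.control ξ s) 2 μ) :
    ∫ ω, (blk (g.uloc ξ μ t ω) (some i) + S.Lloc i t *ᵥ blk (g.lstate ξ μ t ω) (some i)) ⬝ᵥ
        (S.Wloc i t *ᵥ (blk (g.uloc ξ μ t ω) (some i)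
          + S.Lloc i t *ᵥ blk (g.lstate ξ μ t ω) (some i))) ∂μ
      = (∫ ω, g.devLoc ξ μ i t ω ⬝ᵥ (S.Wloc i t *ᵥ g.devLoc ξ μ i t ω) ∂μ)
        + ∫ ω, ξ.errLoc μ i t ω ⬝ᵥ (S.Wloc i t *ᵥ ξ.errLoc μ i t ω) ∂μ := by
  have hmeas : Measurable[ξ.sigMinor i t] (g.devLoc ξ μ i t) :=
    (g.measurable_uloc ξ μ i t).add (measurable_mulVec _
      ((g.measurable_xloc ξ μ i t).add (ξ.measurable_ownHat μ i t)))
  have horth : Orth μ (ξ.errLoc μ i t) (g.devLoc ξ μ i t) :=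
    orth_of_condExp_eq_zero (hξ.sigMinor_le i ht.le) (hξ.memLp_errLoc i ht.le)
      (g.memLp_devLoc hξ i ht hu) (hξ.condExp_errLoc i ht.le) hmeas.stronglyMeasurable
  rw [← integral_quadForm_add (S.Wloc_posDef i t).isHermitian (g.memLp_devLoc hξ i ht hu)
    (hξ.memLp_errLoc i ht.le) horth]
  have h : ∀ ω, blk (g.uloc ξ μ t ω) (some i) + S.Lloc i t *ᵥ blk (g.lstate ξ μ t ω) (some i)
      = g.devLoc ξ μ i t ω + ξ.errLoc μ i t ω := by
    intro ω
    simp only [Strategy.lstate, Strategy.devLoc, Primitives.errLoc, blk_add, Matrix.mulVec_add,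
      Matrix.mulVec_sub]
    abel
  simp only [h]

theorem Primitives.Standard.orth_noise (hξ : ξ.Standard μ) {ι : Type*} [Fintype ι]
    (j : Agent n) {t : ℕ} (ht : t < S.N) {K : Set (PrimIdx n S.N)} {Y : Ω → ι → ℝ}
    (hK : Disjoint {PrimIdx.process j ⟨t, by omega⟩} K)
    (hY : MemLp Y 2 μ) (hYm : Measurable[ξ.sig K] Y) : Orth μ (ξ.w j t) Y := by
  have hw : Measurable[ξ.sig {PrimIdx.process j ⟨t, by omega⟩}] (ξ.w j t) :=
    ξ.measurable_fam (Set.mem_singleton (PrimIdx.process j ⟨t, by omega⟩))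
  have h0 : ∫ ω, ξ.w j t ω ∂μ = 0 := hξ.mean_zero (.process j ⟨t, by omega⟩)
  exact orth_of_indep (hξ.sig_le _) (hξ.sig_le _) (hξ.indep_sig hK) (hξ.memLp_w j ht.le) hY
    hw.stronglyMeasurable hYm.stronglyMeasurable h0

theorem Primitives.Standard.orth_majorPart_noise (hξ : ξ.Standard μ) {ι : Type*} [Fintype ι]
    {t : ℕ} (ht : t < S.N) {Y : Ω → ι → ℝ} (hY : MemLp Y 2 μ)
    (hYm : Measurable[ξ.sig (majorIdx n S.N t)] Y) :
    Orth μ (fun ω => majorPart (ξ.wvec t ω)) Y := by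
  have h := hξ.orth_noise none ht (disjoint_process_majorIdx none ⟨t, by omega⟩) hY hYm
  rintro ⟨_ | i, a⟩ q
  · exact h a q
  · simp [majorPart]

/-- The contribution of the common part to the expected cost. -/
theorem Strategy.common_cost (g : Strategy S) (hξ : ξ.Standard μ)
    (hu : ∀ s < S.N, MemLp (g.control ξ s) 2 μ) :
    ∑ t ∈ Finset.range S.N, ((∫ ω, g.cstate ξ μ t ω ⬝ᵥ (S.Q *ᵥ g.cstate ξ μ t ω) ∂μ)
        + ∫ ω, g.ucom ξ μ t ω ⬝ᵥ (S.R *ᵥ g.ucom ξ μ t ω) ∂μ)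
        + ∫ ω, g.cstate ξ μ S.N ω ⬝ᵥ (S.QT *ᵥ g.cstate ξ μ S.N ω) ∂μ
      = (∫ ω, ξ.mean 0 ω ⬝ᵥ (S.Scom 0 *ᵥ ξ.mean 0 ω) ∂μ)
        + ∑ t ∈ Finset.range S.N, ((∫ ω, majorPart (ξ.wvec t ω) ⬝ᵥ
            (S.Scom (t + 1) *ᵥ majorPart (ξ.wvec t ω)) ∂μ)
          + ∫ ω, g.devCom ξ μ t ω ⬝ᵥ (S.Wcom t *ᵥ g.devCom ξ μ t ω) ∂μ) := by
  have hs : ∀ t ≤ S.N, IsSplit ξ μ t (g.cstate ξ μ t) (g.lstate ξ μ t) := fun t ht =>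
    g.isSplit_state hξ ht fun s hs => hu s (hs.trans_le ht)
  have hc : ∀ t < S.N, IsSplit ξ μ t (g.ucom ξ μ t) (g.uloc ξ μ t) := fun t ht =>
    g.isSplit_control hξ ht.le (hu t ht)
  rw [lq_cost_eq (A := S.A) (B := S.B) S.Q_psd S.QT_psd S.R_pd S.N (x := g.cstate ξ μ)
    (w := fun t ω => majorPart (ξ.wvec t ω)) (u := g.ucom ξ μ)
    (fun t ht => (hs t ht).memLp_com) (fun t ht => (hc t ht).memLp_com)
    (fun t ht => memLp_majorPart (X := ξ.wvec t) (hξ.memLp_w none ht.le))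
    (fun t _ => ae_of_all _ (g.cstate_succ ξ μ t))
    (fun t ht => hξ.orth_majorPart_noise ht (hs t ht.le).memLp_com (hs t ht.le).measurable_com)
    fun t ht => hξ.orth_majorPart_noise ht (hc t ht).memLp_com (hc t ht).measurable_com]
  simp only [g.cstate_zero]
  rfl

/-- The contribution of a minor agent to the expected cost. -/
theorem Strategy.local_cost (g : Strategy S) (hξ : ξ.Standard μ)
    (hu : ∀ s < S.N, MemLp (g.control ξ s) 2 μ) (i : Fin n) :
    ∑ t ∈ Finset.range S.N,
        ((∫ ω, blk (g.lstate ξ μ t ω) (some i) ⬝ᵥ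
          (diagBlk S.Q (some i) *ᵥ blk (g.lstate ξ μ t ω) (some i)) ∂μ)
        + ∫ ω, blk (g.uloc ξ μ t ω) (some i) ⬝ᵥ
          (diagBlk S.R (some i) *ᵥ blk (g.uloc ξ μ t ω) (some i)) ∂μ)
        + ∫ ω, blk (g.lstate ξ μ S.N ω) (some i) ⬝ᵥ
          (diagBlk S.QT (some i) *ᵥ blk (g.lstate ξ μ S.N ω) (some i)) ∂μ
      = (∫ ω, blk (ξ.own 0 ω) (some i) ⬝ᵥ (S.Sloc i 0 *ᵥ blk (ξ.own 0 ω) (some i)) ∂μ)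
        + ∑ t ∈ Finset.range S.N, ((∫ ω, ξ.w (some i) t ω ⬝ᵥ
            (S.Sloc i (t + 1) *ᵥ ξ.w (some i) t ω) ∂μ)
          + ((∫ ω, g.devLoc ξ μ i t ω ⬝ᵥ (S.Wloc i t *ᵥ g.devLoc ξ μ i t ω) ∂μ)
            + ∫ ω, ξ.errLoc μ i t ω ⬝ᵥ (S.Wloc i t *ᵥ ξ.errLoc μ i t ω) ∂μ)) := by
  have hs : ∀ t ≤ S.N, IsSplit ξ μ t (g.cstate ξ μ t) (g.lstate ξ μ t) := fun t ht =>
    g.isSplit_state hξ ht fun s hs => hu s (hs.trans_le ht)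
  have hc : ∀ t < S.N, IsSplit ξ μ t (g.ucom ξ μ t) (g.uloc ξ μ t) := fun t ht =>
    g.isSplit_control hξ ht.le (hu t ht)
  rw [lq_cost_eq (A := diagBlk S.A (some i)) (B := diagBlk S.B (some i))
    (diagBlk_posSemidef S.Q_psd (some i)) (diagBlk_posSemidef S.QT_psd (some i))
    (diagBlk_posDef S.R_pd (some i)) S.N (x := fun t ω => blk (g.lstate ξ μ t ω) (some i))
    (w := ξ.w (some i)) (u := fun t ω => blk (g.uloc ξ μ t ω) (some i))
    (fun t ht => memLp_blk (hs t ht).memLp_loc _) (fun t ht => memLp_blk (hc t ht).memLp_loc _)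
    (fun t ht => hξ.memLp_w _ ht.le)
    (fun t ht => g.lstate_succ hξ i ht fun s hs => (hu s hs).integrable one_le_two)
    (fun t ht => hξ.orth_noise (some i) ht (disjoint_process_minorIdx (some i) i ⟨t, by omega⟩)
      (memLp_blk (hs t ht.le).memLp_loc _) ((hs t ht.le).measurable_loc i))
    fun t ht => hξ.orth_noise (some i) ht (disjoint_process_minorIdx (some i) i ⟨t, by omega⟩)
      (memLp_blk (hc t ht).memLp_loc _) ((hc t ht).measurable_loc i)]
  simp only [g.lstate_zero]
  congr 1
  refine Finset.sum_congr rfl fun t ht => ?_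
  rw [← g.integral_local_square hξ i (Finset.mem_range.1 ht) hu]
  rfl

theorem Strategy.integrable_pathCost (g : Strategy S) (hξ : ξ.Standard μ)
    (hu : ∀ s < S.N, MemLp (g.control ξ s) 2 μ) :
    Integrable (g.pathCost ξ) μ ∧ ∫ ω, g.pathCost ξ ω ∂μ
      = ∑ t ∈ Finset.range S.N, ((∫ ω, g.state ξ t ω ⬝ᵥ (S.Q *ᵥ g.state ξ t ω) ∂μ)
        + ∫ ω, g.control ξ t ω ⬝ᵥ (S.R *ᵥ g.control ξ t ω) ∂μ)
        + ∫ ω, g.state ξ S.N ω ⬝ᵥ (S.QT *ᵥ g.state ξ S.N ω) ∂μ := by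
  have hx : ∀ t ≤ S.N, MemLp (g.state ξ t) 2 μ := by
    intro t ht
    have hs := g.isSplit_state hξ ht fun s hs => hu s (hs.trans_le ht)
    rw [show g.state ξ t = fun ω => g.cstate ξ μ t ω + g.lstate ξ μ t ω from
      funext (g.state_split ξ μ t)]
    exact hs.memLp_com.add hs.memLp_loc
  have h₁ : ∀ t ∈ Finset.range S.N, Integrable (fun ω => g.state ξ t ω ⬝ᵥ (S.Q *ᵥ g.state ξ t ω))
      μ := fun t ht => integrable_dotProduct_mulVec (hx t (Finset.mem_range.1 ht).le)
        (hx t (Finset.mem_range.1 ht).le) _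
  have h₂ : ∀ t ∈ Finset.range S.N, Integrable (fun ω => g.control ξ t ω ⬝ᵥ
      (S.R *ᵥ g.control ξ t ω)) μ := fun t ht => integrable_dotProduct_mulVec
        (hu t (Finset.mem_range.1 ht)) (hu t (Finset.mem_range.1 ht)) _
  have h₃ : ∀ t ∈ Finset.range S.N, Integrable (fun ω => g.state ξ t ω ⬝ᵥ (S.Q *ᵥ g.state ξ t ω)
      + g.control ξ t ω ⬝ᵥ (S.R *ᵥ g.control ξ t ω)) μ := fun t ht => (h₁ t ht).add (h₂ t ht)
  have h₄ := integrable_dotProduct_mulVec (hx S.N le_rfl) (hx S.N le_rfl) S.QT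
  refine ⟨(integrable_finsetSum _ h₃).add h₄, ?_⟩
  simp only [Strategy.pathCost]
  rw [integral_add (integrable_finsetSum _ h₃) h₄, integral_finsetSum _ h₃]
  congr 1
  exact Finset.sum_congr rfl fun t ht => integral_add (h₁ t ht) (h₂ t ht)

/-- The expected cost is a constant plus the expected squares of the deviations from the
optimal feedback. -/
theorem Strategy.integral_pathCost (g : Strategy S) (hξ : ξ.Standard μ)
    (hu : ∀ s < S.N, MemLp (g.control ξ s) 2 μ) :
    ∫ ω, g.pathCost ξ ω ∂μ = ξ.baseCost μ + ∑ t ∈ Finset.range S.N,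
      ((∫ ω, g.devCom ξ μ t ω ⬝ᵥ (S.Wcom t *ᵥ g.devCom ξ μ t ω) ∂μ)
        + ∑ i : Fin n, ∫ ω, g.devLoc ξ μ i t ω ⬝ᵥ (S.Wloc i t *ᵥ g.devLoc ξ μ i t ω) ∂μ) := by
  have hs : ∀ t ≤ S.N, IsSplit ξ μ t (g.cstate ξ μ t) (g.lstate ξ μ t) := fun t ht =>
    g.isSplit_state hξ ht fun s hs => hu s (hs.trans_le ht)
  have hc : ∀ t < S.N, IsSplit ξ μ t (g.ucom ξ μ t) (g.uloc ξ μ t) := fun t ht =>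
    g.isSplit_control hξ ht.le (hu t ht)
  rw [(g.integrable_pathCost hξ hu).2]
  simp only [g.state_split ξ μ, g.control_split ξ μ]
  -- Each quadratic form is separated, then the sums over time and agents are exchanged to regroup
  -- the cost into the common problem and one problem per minor agent.
  rw [(hs S.N le_rfl).integral_quadForm hξ S.QT_psd.isHermitian,
    Finset.sum_congr rfl fun t ht => by
      rw [(hs t (Finset.mem_range.1 ht).le).integral_quadForm hξ S.Q_psd.isHermitian,
        (hc t (Finset.mem_range.1 ht)).integral_quadForm hξ S.R_pd.isHermitian,
        add_add_add_comm, ← Finset.sum_add_distrib],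
    Finset.sum_add_distrib, add_add_add_comm, g.common_cost hξ hu, Finset.sum_comm,
    ← Finset.sum_add_distrib, Finset.sum_congr rfl fun i _ => g.local_cost hξ hu i,
    Primitives.baseCost]
  simp only [Finset.sum_add_distrib]
  rw [Finset.sum_comm (s := Finset.range S.N)]
  ring

end Cost

/-! ### Finite cost and square integrability -/

section Finite

variable {n : ℕ} {S : System n} {Ω : Type*} {m₀ : MeasurableSpace Ω} {μ : Measure Ω}
  {ξ : Primitives S Ω}

theorem Strategy.pathCost_nonneg (g : Strategy S) (ξ : Primitives S Ω) (ω : Ω) :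
    0 ≤ g.pathCost ξ ω :=
  add_nonneg (Finset.sum_nonneg fun _ _ => add_nonneg (posSemidef_quadForm_nonneg S.Q_psd _)
    (posSemidef_quadForm_nonneg S.R_pd.posSemidef _)) (posSemidef_quadForm_nonneg S.QT_psd _)

theorem Strategy.control_cost_le (g : Strategy S) (ξ : Primitives S Ω) {t : ℕ} (ht : t < S.N)
    (ω : Ω) : g.control ξ t ω ⬝ᵥ (S.R *ᵥ g.control ξ t ω) ≤ g.pathCost ξ ω := by
  have h₁ := Finset.single_le_sum (f := fun t => g.state ξ t ω ⬝ᵥ (S.Q *ᵥ g.state ξ t ω)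
    + g.control ξ t ω ⬝ᵥ (S.R *ᵥ g.control ξ t ω)) (fun _ _ => add_nonneg
      (posSemidef_quadForm_nonneg S.Q_psd _) (posSemidef_quadForm_nonneg S.R_pd.posSemidef _))
    (Finset.mem_range.2 ht)
  have h₂ := posSemidef_quadForm_nonneg S.Q_psd (g.state ξ t ω)
  have h₃ := posSemidef_quadForm_nonneg S.QT_psd (g.state ξ S.N ω)
  rw [Strategy.pathCost]
  linarith

theorem Strategy.memLp_control_of_J_ne_top (g : Strategy S) (hξ : ξ.Standard μ)
    (hJ : g.J ξ μ ≠ ⊤) {t : ℕ} (ht : t < S.N) : MemLp (g.control ξ t) 2 μ := by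
  have hm := g.measurable_control hξ ht.le
  have hq : Integrable (fun ω => g.control ξ t ω ⬝ᵥ (S.R *ᵥ g.control ξ t ω)) μ := by
    refine ⟨Measurable.aestronglyMeasurable ?_, ?_⟩
    · simp only [dotProduct]
      exact Finset.measurable_sum _ fun p _ => ((measurable_pi_apply p).comp hm).mul
        ((measurable_pi_apply p).comp (measurable_mulVec S.R hm))
    · rw [hasFiniteIntegral_iff_ofReal
        (ae_of_all _ fun ω => posSemidef_quadForm_nonneg S.R_pd.posSemidef _)]
      exact (lintegral_mono fun ω => ENNReal.ofReal_le_ofReal (g.control_cost_le ξ ht ω)).trans_lt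
        (lt_top_iff_ne_top.2 hJ)
  refine MemLp.of_eval fun p => ?_
  have hp : Measurable fun ω => g.control ξ t ω p := (measurable_pi_apply p).comp hm
  rw [memLp_two_iff_integrable_sq hp.aestronglyMeasurable]
  refine (hq.const_mul (S.R⁻¹ p p)).mono' (hp.pow_const 2).aestronglyMeasurable
    (ae_of_all _ fun ω => ?_)
  rw [Real.norm_of_nonneg (sq_nonneg _)]
  exact posDef_quadForm_coercive S.R_pd p _

theorem Strategy.J_eq [IsProbabilityMeasure μ] (g : Strategy S) (hξ : ξ.Standard μ)
    (hu : ∀ s < S.N, MemLp (g.control ξ s) 2 μ) :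
    g.J ξ μ = ENNReal.ofReal (∫ ω, g.pathCost ξ ω ∂μ) :=
  (ofReal_integral_eq_lintegral_ofReal (g.integrable_pathCost hξ hu).1
    (ae_of_all _ fun ω => g.pathCost_nonneg ξ ω)).symm

end Finite

/-! ### Strategies in feedback form -/

section Feedback

variable {n : ℕ} {S : System n} {Ω : Type*} {m₀ : MeasurableSpace Ω} {μ : Measure Ω}
  {ξ : Primitives S Ω}

/-- The controls are square integrable and follow the optimal feedback. -/
def Strategy.IsFeedback (g : Strategy S) (ξ : Primitives S Ω) (μ : Measure Ω) : Prop :=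
  ∀ t < S.N, MemLp (g.control ξ t) 2 μ ∧ g.devCom ξ μ t =ᵐ[μ] 0 ∧
    ∀ i : Fin n, g.devLoc ξ μ i t =ᵐ[μ] 0

theorem driven_ae_congr {u u' : ℕ → Ω → Stacked S.du} {t : ℕ}
    (h : ∀ s < t, u s =ᵐ[μ] u' s) : driven S u t =ᵐ[μ] driven S u' t := by
  have h' : ∀ᵐ ω ∂μ, ∀ s : Fin t, u s ω = u' s ω := ae_all_iff.2 fun s => h s s.2
  filter_upwards [h'] with ω hω
  exact driven_congr fun s hs => hω ⟨s, hs⟩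

variable [IsProbabilityMeasure μ]

/-- The estimates at time `t` are replaced by their explicit forms, which depend only on earlier
controls; so no square integrability at time `t` itself is required. -/
theorem Strategy.feedback_iff (g : Strategy S) (hξ : ξ.Standard μ) {t : ℕ} (ht : t < S.N)
    (hu : ∀ s < t, MemLp (g.control ξ s) 2 μ) :
    ((∀ᵐ ω ∂μ, g.ucom ξ μ t ω = -(S.Lcom t *ᵥ g.zhatCom ξ μ t ω)) ∧
        ∀ i : Fin n, ∀ᵐ ω ∂μ,
          blk (g.uloc ξ μ t ω) (some i) = -(S.Lloc i t *ᵥ g.zhatLoc ξ μ i t ω)) ↔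
      g.devCom ξ μ t =ᵐ[μ] 0 ∧ ∀ i : Fin n, g.devLoc ξ μ i t =ᵐ[μ] 0 := by
  have hc := g.zhatCom_eq hξ ht.le hu
  have hl := fun i => g.zhatLoc_eq hξ i ht.le hu
  refine and_congr (Filter.eventually_congr (hc.mono fun ω hω => ?_))
    (forall_congr' fun i => Filter.eventually_congr ((hl i).mono fun ω hω => ?_))
  · rw [hω, eq_neg_iff_add_eq_zero]
    rfl
  · rw [hω, eq_neg_iff_add_eq_zero]
    rfl

theorem Strategy.isFeedback_iff (g : Strategy S) (hξ : ξ.Standard μ) :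
    g.IsFeedback ξ μ ↔ ∀ t < S.N, Integrable (g.control ξ t) μ ∧
        (∀ᵐ ω ∂μ, g.ucom ξ μ t ω = -(S.Lcom t *ᵥ g.zhatCom ξ μ t ω)) ∧
        ∀ i : Fin n, ∀ᵐ ω ∂μ,
          blk (g.uloc ξ μ t ω) (some i) = -(S.Lloc i t *ᵥ g.zhatLoc ξ μ i t ω) := by
  constructor
  · intro h t ht
    exact ⟨(h t ht).1.integrable one_le_two,
      (g.feedback_iff hξ ht fun s hs => (h s (hs.trans ht)).1).2 (h t ht).2⟩
  · intro h
    -- Integrability upgrades to square integrability: with earlier controls in `L²` the estimates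
    -- are in `L²`, and the feedback law passes this on to the control. Integrability at time `t`
    -- serves to make the major block of the local control vanish.
    have hL : ∀ t < S.N, MemLp (g.control ξ t) 2 μ := by
      intro t
      induction t using Nat.strong_induction_on with
      | _ t ih =>
        intro ht
        have hu : ∀ s < t, MemLp (g.control ξ s) 2 μ := fun s hs => ih s hs (hs.trans ht)
        obtain ⟨hi, hcom, hloc⟩ := h t ht
        have hs := g.isSplit_state hξ ht.le hu
        have hcomL : MemLp (g.ucom ξ μ t) 2 μ := by
          refine (memLp_congr_ae ?_).2 (memLp_mulVec hs.memLp_com (S.Lcom t)).neg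
          filter_upwards [hcom, g.zhatCom_eq hξ ht.le hu] with ω h₁ h₂
          rw [h₁, h₂]
          rfl
        have hlocL : MemLp (g.uloc ξ μ t) 2 μ := by
          refine memLp_stacked fun j => ?_
          cases j with
          | none => exact (memLp_congr_ae (g.uloc_none hξ ht.le hi)).2 MemLp.zero'
          | some i =>
            have hx : MemLp (g.xloc ξ μ t) 2 μ := memLp_driven fun s hs => g.memLp_uloc (hu s hs)
            refine (memLp_congr_ae ?_).2 (memLp_mulVec ((memLp_blk hx (some i)).add
              (hξ.memLp_ownHat i ht.le)) (S.Lloc i t)).neg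
            filter_upwards [hloc i, g.zhatLoc_eq hξ i ht.le hu] with ω h₁ h₂
            rw [h₁, h₂]
            rfl
        rw [show g.control ξ t = fun ω => g.ucom ξ μ t ω + g.uloc ξ μ t ω from
          funext (g.control_split ξ μ t)]
        exact hcomL.add hlocL
    intro t ht
    exact ⟨hL t ht, (g.feedback_iff hξ ht fun s hs => hL s (hs.trans ht)).1 (h t ht).2⟩

/-- Strategies in feedback form generate almost surely the same controls. -/
theorem Strategy.IsFeedback.control_ae_eq {g g' : Strategy S} (hξ : ξ.Standard μ)
    (h : g.IsFeedback ξ μ) (h' : g'.IsFeedback ξ μ) {t : ℕ} (ht : t < S.N) :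
    g.control ξ t =ᵐ[μ] g'.control ξ t := by
  induction t using Nat.strong_induction_on with
  | _ t ih =>
    -- The conditioning sigma-algebra is the same for both strategies, so equal controls have equal
    -- common parts.
    have hcom : ∀ s < t, g.ucom ξ μ s =ᵐ[μ] g'.ucom ξ μ s := by
      intro s hs
      rw [Strategy.ucom, Strategy.ucom, g.sigmaCom_eq, g'.sigmaCom_eq]
      exact condExp_congr_ae (ih s hs (hs.trans ht))
    have hloc : ∀ s < t, g.uloc ξ μ s =ᵐ[μ] g'.uloc ξ μ s := by
      intro s hs
      filter_upwards [hcom s hs, ih s hs (hs.trans ht)] with ω h₁ h₂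
      rw [Strategy.uloc, Strategy.uloc, h₁, h₂]
    filter_upwards [driven_ae_congr hcom, driven_ae_congr hloc, (h t ht).2.1, (h' t ht).2.1,
      ae_all_iff.2 (h t ht).2.2, ae_all_iff.2 (h' t ht).2.2,
      g.uloc_none hξ ht.le ((h t ht).1.integrable one_le_two),
      g'.uloc_none hξ ht.le ((h' t ht).1.integrable one_le_two)]
      with ω hxc hxl hc hc' hl hl' h0 h0'
    -- Past controls agree, hence so do the states; the vanishing deviations then force the controls
    -- at time `t` to agree.
    rw [Strategy.devCom, Pi.zero_apply, Strategy.cstate, Strategy.xcom] at hc hc'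
    rw [← hxc, ← hc] at hc'
    rw [g.control_split ξ μ, g'.control_split ξ μ, add_right_cancel hc']
    congr 1
    refine stacked_ext fun j => ?_
    cases j with
    | none => rw [h0, h0']
    | some i =>
      have e := hl i
      have e' := hl' i
      rw [Strategy.devLoc, Pi.zero_apply, Strategy.xloc] at e e'
      rw [← hxl, ← e] at e'
      exact (add_right_cancel e').symm

end Feedback

/-! ### Existence of a strategy in feedback form -/

section Existence

variable {n : ℕ} {S : System n} {Ω : Type*} {m₀ : MeasurableSpace Ω} {μ : Measure Ω}
  {ξ : Primitives S Ω}

/-- The common part of the state under the optimal feedback. -/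
noncomputable def Primitives.optCom (ξ : Primitives S Ω) : ℕ → Ω → Stacked S.dx
  | 0 => ξ.mean 0
  | t + 1 => fun ω => S.A *ᵥ ξ.optCom t ω + S.B *ᵥ (-(S.Lcom t *ᵥ ξ.optCom t ω))
      + majorPart (ξ.wvec t ω)

/-- The controlled local state of minor agent `i` under the optimal feedback. -/
noncomputable def Primitives.optLoc (ξ : Primitives S Ω) (μ : Measure Ω) (i : Fin n) :
    ℕ → Ω → Fin (S.dx (some i)) → ℝ
  | 0 => fun _ => 0
  | t + 1 => fun ω => diagBlk S.A (some i) *ᵥ ξ.optLoc μ i t ω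
      + diagBlk S.B (some i) *ᵥ (-(S.Lloc i t *ᵥ (ξ.optLoc μ i t ω + ξ.ownHat μ i t ω)))

/-- The common part of the optimal control. -/
noncomputable def Primitives.optUcom (ξ : Primitives S Ω) (t : ℕ) (ω : Ω) : Stacked S.du :=
  -(S.Lcom t *ᵥ ξ.optCom t ω)

/-- The local part of the optimal control. -/
noncomputable def Primitives.optUloc (ξ : Primitives S Ω) (μ : Measure Ω) (t : ℕ) (ω : Ω) :
    Stacked S.du
  | ⟨none, _⟩ => 0
  | ⟨some i, a⟩ => (-(S.Lloc i t *ᵥ (ξ.optLoc μ i t ω + ξ.ownHat μ i t ω))) a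

theorem Primitives.blk_optUloc_none (ξ : Primitives S Ω) (t : ℕ) (ω : Ω) :
    blk (ξ.optUloc μ t ω) none = 0 := rfl

theorem Primitives.blk_optUloc_some (ξ : Primitives S Ω) (i : Fin n) (t : ℕ) (ω : Ω) :
    blk (ξ.optUloc μ t ω) (some i)
      = -(S.Lloc i t *ᵥ (ξ.optLoc μ i t ω + ξ.ownHat μ i t ω)) := rfl

theorem Primitives.driven_optUcom (ξ : Primitives S Ω) (ω : Ω) :
    ∀ t, driven S ξ.optUcom t ω + ξ.mean t ω = ξ.optCom t ω
  | 0 => by simp [driven, Primitives.optCom]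
  | t + 1 => by
    have h := ξ.driven_optUcom ω t
    simp only [driven, Primitives.mean, Primitives.optCom]
    rw [← h, Matrix.mulVec_add, Primitives.optUcom, h]
    abel

theorem Primitives.blk_driven_optUloc (ξ : Primitives S Ω) (i : Fin n) (ω : Ω) (t : ℕ) :
    blk (driven S (ξ.optUloc μ) t ω) (some i) = ξ.optLoc μ i t ω := by
  have h0 : ∀ r, blk (driven S (ξ.optUloc μ) r ω) none = 0 := by
    intro r
    induction r with
    | zero => rfl
    | succ r ih => simp [blk_driven_none_succ, ih, ξ.blk_optUloc_none]
  induction t with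
  | zero => rfl
  | succ t ih =>
    simp [blk_driven_some_succ, ih, h0, ξ.blk_optUloc_none, ξ.blk_optUloc_some,
      Primitives.optLoc]

theorem Primitives.measurable_optCom (ξ : Primitives S Ω) {t : ℕ} (ht : t ≤ S.N) :
    Measurable[ξ.sigMajor t] (ξ.optCom t) := by
  rw [ξ.sigMajor_eq ht]
  have hu : ∀ r ≤ t, Measurable[ξ.sig (majorIdx n S.N r)] (ξ.optCom r) := by
    intro r
    induction r using Nat.strong_induction_on with
    | _ r ih =>
      intro hr
      rw [show ξ.optCom r = fun ω => driven S ξ.optUcom r ω + ξ.mean r ω from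
        funext fun ω => (ξ.driven_optUcom ω r).symm]
      refine Measurable.add (measurable_driven fun s hs => ?_) (ξ.measurable_mean (hr.trans ht))
      exact (measurable_mulVec _ ((ih s hs (hs.le.trans hr)).mono
        (ξ.sig_mono (majorIdx_mono n S.N hs.le)) le_rfl)).neg
  exact hu t le_rfl

theorem Primitives.measurable_optLoc (ξ : Primitives S Ω) (i : Fin n) (t : ℕ) :
    Measurable[ξ.sigMinor i t] (ξ.optLoc μ i t) := by
  induction t with
  | zero => exact measurable_const
  | succ t ih =>
    have h₁ := ih.mono (ξ.sigMinor_mono i (Nat.le_succ t)) le_rfl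
    have h₂ := (ξ.measurable_ownHat μ i t).mono (ξ.sigMinor_mono i (Nat.le_succ t)) le_rfl
    exact (measurable_mulVec _ h₁).add (measurable_mulVec _ (measurable_mulVec _ (h₁.add h₂)).neg)

theorem Primitives.Standard.memLp_optCom (hξ : ξ.Standard μ) {t : ℕ} (ht : t ≤ S.N) :
    MemLp (ξ.optCom t) 2 μ := by
  induction t using Nat.strong_induction_on with
  | _ t ih =>
    rw [show ξ.optCom t = fun ω => driven S ξ.optUcom t ω + ξ.mean t ω from
      funext fun ω => (ξ.driven_optUcom ω t).symm]
    have hd : MemLp (driven S ξ.optUcom t) 2 μ := memLp_driven fun s hs =>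
      (memLp_mulVec (ih s hs (hs.le.trans ht)) (S.Lcom s)).neg
    exact hd.add (hξ.memLp_mean ht)

theorem Primitives.Standard.memLp_optLoc (hξ : ξ.Standard μ) (i : Fin n) {t : ℕ}
    (ht : t ≤ S.N) : MemLp (ξ.optLoc μ i t) 2 μ := by
  induction t with
  | zero => exact MemLp.zero'
  | succ t ih =>
    have h₁ := ih (by omega)
    have h₂ : MemLp (fun ω => ξ.optLoc μ i t ω + ξ.ownHat μ i t ω) 2 μ :=
      h₁.add (hξ.memLp_ownHat i (by omega))
    have h₃ : MemLp (fun ω => -(S.Lloc i t *ᵥ (ξ.optLoc μ i t ω + ξ.ownHat μ i t ω))) 2 μ :=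
      (memLp_mulVec h₂ (S.Lloc i t)).neg
    exact (memLp_mulVec h₁ (diagBlk S.A (some i))).add
      (memLp_mulVec h₃ (diagBlk S.B (some i)))

theorem condExp_mulVec_eq_zero {ι κ : Type*} [Fintype ι] [Fintype κ] {m : MeasurableSpace Ω}
    {X : Ω → ι → ℝ} (hX : Integrable X μ) (h : μ[X | m] =ᵐ[μ] 0) (M : Matrix κ ι ℝ) :
    μ[fun ω => M *ᵥ X ω | m] =ᵐ[μ] 0 := by
  filter_upwards [condExp_mulVec (m := m) hX M, h] with ω h₁ h₂
  rw [← h₁, h₂]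
  exact Matrix.mulVec_zero M

theorem condExp_add_eq_zero {ι : Type*} [Fintype ι] {m : MeasurableSpace Ω}
    {X Y : Ω → ι → ℝ} (hX : Integrable X μ) (hY : Integrable Y μ) (h : μ[X | m] =ᵐ[μ] 0)
    (h' : μ[Y | m] =ᵐ[μ] 0) : μ[fun ω => X ω + Y ω | m] =ᵐ[μ] 0 := by
  refine (condExp_add hX hY m).trans ?_
  filter_upwards [h, h'] with ω h₁ h₂
  rw [Pi.add_apply, h₁, h₂, Pi.zero_apply, add_zero]

theorem condExp_neg_eq_zero {ι : Type*} [Fintype ι] {m : MeasurableSpace Ω}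
    {X : Ω → ι → ℝ} (h : μ[X | m] =ᵐ[μ] 0) : μ[fun ω => -X ω | m] =ᵐ[μ] 0 := by
  refine (condExp_neg X m).trans ?_
  filter_upwards [h] with ω h₁
  rw [Pi.neg_apply, h₁, Pi.zero_apply, neg_zero]

theorem Primitives.Standard.memLp_optUloc (hξ : ξ.Standard μ) {t : ℕ} (ht : t ≤ S.N) :
    MemLp (ξ.optUloc μ t) 2 μ := by
  refine memLp_stacked fun j => ?_
  cases j with
  | none => exact MemLp.zero'
  | some i =>
    have h : MemLp (fun ω => ξ.optLoc μ i t ω + ξ.ownHat μ i t ω) 2 μ :=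
      (hξ.memLp_optLoc i ht).add (hξ.memLp_ownHat i ht)
    exact (memLp_mulVec h (S.Lloc i t)).neg

variable [IsProbabilityMeasure μ]

/-- Common information after time `s` can be dropped, and the tower property reduces the claim to
the centering of the `own` part. -/
theorem Primitives.Standard.condExp_ownHat (hξ : ξ.Standard μ) (i : Fin n) {s t : ℕ}
    (hst : s ≤ t) (ht : t ≤ S.N) : μ[ξ.ownHat μ i s | ξ.sigMajor t] =ᵐ[μ] 0 := by
  have hs := hst.trans ht
  rw [ξ.sigMajor_eq ht]
  refine (hξ.condExp_sig _ ((ξ.measurable_ownHat μ i s).mono (ξ.sigMinor_le i hs)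
    le_rfl).stronglyMeasurable).trans ?_
  rw [majorIdx_inter_minorIdx i hst, ← ξ.sigMajor_eq hs]
  refine (condExp_condExp_of_le (ξ.sigMajor_le_sigMinor i s) (hξ.sigMinor_le i hs)).trans ?_
  exact condExp_blk_eq_zero ((hξ.memLp_own hs).integrable one_le_two) (hξ.condExp_own hs) _

theorem Primitives.Standard.condExp_optLoc (hξ : ξ.Standard μ) (i : Fin n) {t : ℕ}
    (ht : t ≤ S.N) : ∀ r ≤ t, μ[ξ.optLoc μ i r | ξ.sigMajor t] =ᵐ[μ] 0 := by
  intro r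
  induction r with
  | zero =>
    intro _
    rw [show ξ.optLoc μ i 0 = fun _ => 0 from rfl, condExp_const (hξ.sigMajor_le ht)]
    rfl
  | succ r ih =>
    intro hr
    have h₁ : Integrable (ξ.optLoc μ i r) μ :=
      (hξ.memLp_optLoc i (by omega)).integrable one_le_two
    have h₂ : Integrable (ξ.ownHat μ i r) μ :=
      (hξ.memLp_ownHat i (by omega)).integrable one_le_two
    have h₃ := condExp_neg_eq_zero (condExp_mulVec_eq_zero (h₁.add h₂)
      (condExp_add_eq_zero h₁ h₂ (ih (by omega)) (hξ.condExp_ownHat i (by omega) ht))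
      (S.Lloc i r))
    have h₄ := (integrable_mulVec (h₁.add h₂) (S.Lloc i r)).neg
    exact condExp_add_eq_zero (integrable_mulVec h₁ _) (integrable_mulVec h₄ _)
      (condExp_mulVec_eq_zero h₁ (ih (by omega)) (diagBlk S.A (some i)))
      (condExp_mulVec_eq_zero h₄ h₃ (diagBlk S.B (some i)))

theorem Primitives.Standard.condExp_optUloc (hξ : ξ.Standard μ) {t : ℕ} (ht : t ≤ S.N) :
    μ[ξ.optUloc μ t | ξ.sigMajor t] =ᵐ[μ] 0 := by
  refine condExp_stacked_eq_zero ((hξ.memLp_optUloc ht).integrable one_le_two) fun j => ?_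
  cases j with
  | none =>
    simp only [ξ.blk_optUloc_none]
    rw [condExp_const (hξ.sigMajor_le ht)]
    rfl
  | some i =>
    have h₁ : Integrable (ξ.optLoc μ i t) μ := (hξ.memLp_optLoc i ht).integrable one_le_two
    have h₂ : Integrable (ξ.ownHat μ i t) μ := (hξ.memLp_ownHat i ht).integrable one_le_two
    exact condExp_neg_eq_zero (condExp_mulVec_eq_zero (h₁.add h₂)
      (condExp_add_eq_zero h₁ h₂ (hξ.condExp_optLoc i ht t le_rfl)
        (hξ.condExp_ownHat i le_rfl ht)) (S.Lloc i t))

/-- Some strategy follows the optimal feedback. -/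
theorem Primitives.Standard.exists_isFeedback (hξ : ξ.Standard μ) :
    ∃ g : Strategy S, g.IsFeedback ξ μ := by
  obtain ⟨g, hg⟩ := ξ.exists_strategy
    -- A strategy needs laws at all times, but the adaptedness of the common feedback is established
    -- only within the horizon; later inputs do not affect the cost and are set to zero.
    (fun t ω => if t < S.N then ξ.optUcom t ω + ξ.optUloc μ t ω else 0)
    (by
      intro t
      split_ifs with ht
      · simp only [blk_add, ξ.blk_optUloc_none, add_zero]
        exact measurable_blk (measurable_mulVec _ (ξ.measurable_optCom ht.le)).neg none
      · exact (measurable_const : Measurable[ξ.sigMajor t] fun _ => (0 : Fin _ → ℝ)))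
    (by
      intro i t
      split_ifs with ht
      · refine Measurable.add ?_ ?_
        · exact (measurable_blk (measurable_mulVec _ (ξ.measurable_optCom ht.le)).neg _).mono
            (ξ.sigMajor_le_sigMinor i t) le_rfl
        · exact (measurable_mulVec _
            ((ξ.measurable_optLoc i t).add (ξ.measurable_ownHat μ i t))).neg
      · exact (measurable_const : Measurable[ξ.sigMinor i t] fun _ => (0 : Fin _ → ℝ)))
  have hc : ∀ t < S.N, g.control ξ t = ξ.optUcom t + ξ.optUloc μ t := by
    intro t ht
    rw [hg t]
    simp only [if_pos ht]
    rfl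
  have hcL : ∀ t < S.N, MemLp (ξ.optUcom t) 2 μ := fun t ht =>
    (memLp_mulVec (hξ.memLp_optCom ht.le) (S.Lcom t)).neg
  have hL : ∀ t < S.N, MemLp (g.control ξ t) 2 μ := fun t ht => by
    rw [hc t ht]
    exact (hcL t ht).add (hξ.memLp_optUloc ht.le)
  -- The two summands are indeed the common and local parts of their sum: the first is known from
  -- the common information and the second is centered given it.
  have hcom : ∀ t < S.N, g.ucom ξ μ t =ᵐ[μ] ξ.optUcom t := by
    intro t ht
    rw [Strategy.ucom, g.sigmaCom_eq, hc t ht]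
    refine (condExp_add ((hcL t ht).integrable one_le_two)
      ((hξ.memLp_optUloc ht.le).integrable one_le_two) _).trans ?_
    rw [condExp_of_stronglyMeasurable (hξ.sigMajor_le ht.le)
      (measurable_mulVec _ (ξ.measurable_optCom ht.le)).neg.stronglyMeasurable
      ((hcL t ht).integrable one_le_two)]
    filter_upwards [hξ.condExp_optUloc ht.le] with ω hω
    rw [Pi.add_apply, hω, Pi.zero_apply, add_zero]
  have hloc : ∀ t < S.N, g.uloc ξ μ t =ᵐ[μ] ξ.optUloc μ t := by
    intro t ht
    filter_upwards [hcom t ht] with ω hω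
    rw [Strategy.uloc, hω, hc t ht, Pi.add_apply, add_sub_cancel_left]
  refine ⟨g, fun t ht => ⟨hL t ht, ?_, fun i => ?_⟩⟩
  · filter_upwards [hcom t ht, driven_ae_congr fun s hs => hcom s (hs.trans ht)] with ω h₁ h₂
    rw [Strategy.devCom, Strategy.cstate, Strategy.xcom, h₁, h₂, ξ.driven_optUcom]
    exact neg_add_cancel _
  · filter_upwards [hloc t ht, driven_ae_congr fun s hs => hloc s (hs.trans ht)] with ω h₁ h₂
    rw [Strategy.devLoc, Strategy.xloc, h₁, h₂, ξ.blk_driven_optUloc, ξ.blk_optUloc_some]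
    exact neg_add_cancel _

end Existence

/-! ### Optimality -/

section Optimality

variable {n : ℕ} {S : System n} {Ω : Type*} {m₀ : MeasurableSpace Ω} {μ : Measure Ω}
  {ξ : Primitives S Ω}

theorem ae_eq_zero_of_integral_quadForm {ι : Type*} [Fintype ι] {W : Matrix ι ι ℝ}
    (hW : W.PosDef) {X : Ω → ι → ℝ} (hX : MemLp X 2 μ) (h : ∫ ω, X ω ⬝ᵥ (W *ᵥ X ω) ∂μ = 0) :
    X =ᵐ[μ] 0 := by
  have h' := (integral_eq_zero_iff_of_nonneg
    (fun ω => posSemidef_quadForm_nonneg hW.posSemidef (X ω))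
    (integrable_dotProduct_mulVec hX hX W)).1 h
  filter_upwards [h'] with ω hω
  exact posDef_quadForm_eq_zero hW hω

/-- Strategies with almost surely equal controls consist of almost surely equal control laws. -/
theorem Strategy.laws_ae_eq {g g' : Strategy S} (hξ : ξ.Standard μ)
    (h : ∀ t < S.N, g.control ξ t =ᵐ[μ] g'.control ξ t) {t : ℕ} (ht : t < S.N) :
    (∀ᵐ I ∂(μ.map (g.infoMajor ξ t)), g.major t I = g'.major t I) ∧
      ∀ i : Fin n, ∀ᵐ I ∂(μ.map (g.infoMinor ξ i t)), g.minor i t I = g'.minor i t I := by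
  have hall : ∀ᵐ ω ∂μ, ∀ s : Fin (t + 1), g.control ξ s ω = g'.control ξ s ω :=
    ae_all_iff.2 fun s => h s (by omega)
  have hstate : ∀ ω, (∀ s : Fin (t + 1), g.control ξ s ω = g'.control ξ s ω) →
      ∀ s : Fin (t + 1), g.state ξ s ω = g'.state ξ s ω := fun ω hω s =>
    ξ.stateOf_congr ω fun r hr => hω ⟨r, by omega⟩
  have hmajor : ∀ ω, (∀ s : Fin (t + 1), g.control ξ s ω = g'.control ξ s ω) →
      g.infoMajor ξ t ω = g'.infoMajor ξ t ω := fun ω hω =>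
    Prod.ext (funext fun s => congrArg (blk · none) (hstate ω hω s))
      (funext fun s => congrArg (blk · none) (hω s.castSucc))
  have hminor : ∀ ω, (∀ s : Fin (t + 1), g.control ξ s ω = g'.control ξ s ω) →
      ∀ i, g.infoMinor ξ i t ω = g'.infoMinor ξ i t ω := fun ω hω i =>
    Prod.ext (hmajor ω hω) (Prod.ext
      (funext fun s => congrArg (fun x => S.C i *ᵥ blk x (some i) + ξ.v i s ω) (hstate ω hω s))
      (funext fun s => congrArg (blk · (some i)) (hω s.castSucc)))
  constructor
  · rw [ae_map_iff ((g.measurable_infoMajor ξ t).mono (hξ.sigMajor_le ht.le) le_rfl).aemeasurable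
      (measurableSet_eq_fun (g.measurable_major t) (g'.measurable_major t))]
    filter_upwards [hall] with ω hω
    -- Equal controls mean that each law, evaluated at its own closed-loop information, gives the
    -- same value. Since that information also agrees, the two laws are compared at the same point.
    have e := congrArg (blk · none) (hω (Fin.last t))
    simp only [Fin.val_last, Strategy.blk_control_none] at e
    rwa [← hmajor ω hω] at e
  · intro i
    rw [ae_map_iff
      ((g.measurable_infoMinor ξ i t).mono (hξ.sigMinor_le i ht.le) le_rfl).aemeasurable
      (measurableSet_eq_fun (g.measurable_minor i t) (g'.measurable_minor i t))]
    filter_upwards [hall] with ω hω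
    have e := congrArg (blk · (some i)) (hω (Fin.last t))
    simp only [Fin.val_last, Strategy.blk_control_some] at e
    rwa [← hminor ω hω i] at e

variable [IsProbabilityMeasure μ]

theorem Strategy.baseCost_le (g : Strategy S) (hξ : ξ.Standard μ)
    (hu : ∀ s < S.N, MemLp (g.control ξ s) 2 μ) :
    ξ.baseCost μ ≤ ∫ ω, g.pathCost ξ ω ∂μ := by
  rw [g.integral_pathCost hξ hu]
  refine le_add_of_nonneg_right (Finset.sum_nonneg fun t _ => add_nonneg ?_
    (Finset.sum_nonneg fun i _ => ?_))
  · exact integral_nonneg fun ω => posSemidef_quadForm_nonneg (S.Wcom_posDef t).posSemidef _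
  · exact integral_nonneg fun ω => posSemidef_quadForm_nonneg (S.Wloc_posDef i t).posSemidef _

/-- The excess over the constant is a sum of nonnegative integrals, which vanishes only termwise;
positive definite weights then make each deviation vanish. -/
theorem Strategy.isFeedback_iff_integral_eq (g : Strategy S) (hξ : ξ.Standard μ)
    (hu : ∀ s < S.N, MemLp (g.control ξ s) 2 μ) :
    g.IsFeedback ξ μ ↔ ∫ ω, g.pathCost ξ ω ∂μ = ξ.baseCost μ := by
  have hcn : ∀ t, 0 ≤ ∫ ω, g.devCom ξ μ t ω ⬝ᵥ (S.Wcom t *ᵥ g.devCom ξ μ t ω) ∂μ := fun t =>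
    integral_nonneg fun ω => posSemidef_quadForm_nonneg (S.Wcom_posDef t).posSemidef _
  have hln : ∀ t (i : Fin n),
      0 ≤ ∫ ω, g.devLoc ξ μ i t ω ⬝ᵥ (S.Wloc i t *ᵥ g.devLoc ξ μ i t ω) ∂μ := fun t i =>
    integral_nonneg fun ω => posSemidef_quadForm_nonneg (S.Wloc_posDef i t).posSemidef _
  rw [g.integral_pathCost hξ hu, add_eq_left, Finset.sum_eq_zero_iff_of_nonneg fun t _ =>
    add_nonneg (hcn t) (Finset.sum_nonneg fun i _ => hln t i)]
  refine forall_congr' fun t => ?_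
  rw [Finset.mem_range]
  refine forall_congr' fun ht => ?_
  rw [add_eq_zero_iff_of_nonneg (hcn t) (Finset.sum_nonneg fun i _ => hln t i),
    Finset.sum_eq_zero_iff_of_nonneg fun i _ => hln t i]
  constructor
  · rintro ⟨-, hc, hl⟩
    refine ⟨?_, fun i _ => ?_⟩
    · refine (integral_congr_ae (hc.mono fun ω hω => ?_)).trans (integral_zero Ω ℝ)
      simp [hω]
    · refine (integral_congr_ae ((hl i).mono fun ω hω => ?_)).trans (integral_zero Ω ℝ)
      simp [hω]
  · rintro ⟨hc, hl⟩
    exact ⟨hu t ht, ae_eq_zero_of_integral_quadForm (S.Wcom_posDef t)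
      (g.memLp_devCom hξ ht hu) hc, fun i => ae_eq_zero_of_integral_quadForm (S.Wloc_posDef i t)
      (g.memLp_devLoc hξ i ht hu) (hl i (Finset.mem_univ i))⟩

theorem Strategy.IsFeedback.J_eq {g : Strategy S} (hξ : ξ.Standard μ) (h : g.IsFeedback ξ μ) :
    g.J ξ μ = ENNReal.ofReal (ξ.baseCost μ) := by
  have hu : ∀ s < S.N, MemLp (g.control ξ s) 2 μ := fun s hs => (h s hs).1
  rw [Strategy.J_eq g hξ hu, (g.isFeedback_iff_integral_eq hξ hu).1 h]

theorem Strategy.ofReal_baseCost_le_J (g : Strategy S) (hξ : ξ.Standard μ) :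
    ENNReal.ofReal (ξ.baseCost μ) ≤ g.J ξ μ := by
  by_cases hJ : g.J ξ μ = ⊤
  · rw [hJ]
    exact le_top
  · have hu : ∀ s < S.N, MemLp (g.control ξ s) 2 μ := fun s hs =>
      g.memLp_control_of_J_ne_top hξ hJ hs
    rw [g.J_eq hξ hu]
    exact ENNReal.ofReal_le_ofReal (g.baseCost_le hξ hu)

theorem Strategy.IsFeedback.isOptimal {g : Strategy S} (hξ : ξ.Standard μ)
    (h : g.IsFeedback ξ μ) : g.IsOptimal ξ μ := fun g' => by
  rw [h.J_eq hξ]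
  exact g'.ofReal_baseCost_le_J hξ

/-- The optimal strategies are exactly those that follow the optimal feedback. -/
theorem Strategy.isOptimal_iff_isFeedback (g : Strategy S) (hξ : ξ.Standard μ) :
    g.IsOptimal ξ μ ↔ g.IsFeedback ξ μ := by
  refine ⟨fun hg => ?_, fun h => h.isOptimal hξ⟩
  -- Comparison with a feedback strategy shows that an optimal strategy has finite cost, hence
  -- square integrable controls, so the cost formula applies to it.
  obtain ⟨g₀, h₀⟩ := hξ.exists_isFeedback
  have hle := hg g₀
  rw [h₀.J_eq hξ] at hle
  have hu : ∀ s < S.N, MemLp (g.control ξ s) 2 μ := fun s hs =>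
    g.memLp_control_of_J_ne_top hξ (ne_top_of_le_ne_top ENNReal.ofReal_ne_top hle) hs
  -- Nonnegativity is needed to read the inequality of extended costs as one of real numbers, as
  -- `ENNReal.ofReal` truncates at zero.
  have hb : 0 ≤ ξ.baseCost μ := by
    rw [← (g₀.isFeedback_iff_integral_eq hξ fun s hs => (h₀ s hs).1).1 h₀]
    exact integral_nonneg fun ω => g₀.pathCost_nonneg ξ ω
  rw [g.J_eq hξ hu, ENNReal.ofReal_le_ofReal_iff hb] at hle
  exact (g.isFeedback_iff_integral_eq hξ hu).2 (le_antisymm hle (g.baseCost_le hξ hu))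

end Optimality

end MajorMinor

theorem mainTheorem3 {n : ℕ} (S : MajorMinor.System n) {Ω : Type*} [MeasurableSpace Ω]
    (μ : MeasureTheory.Measure Ω) [MeasureTheory.IsProbabilityMeasure μ]
    (ξ : MajorMinor.Primitives S Ω) (hξ : ξ.Standard μ) :
    -- an optimal strategy exists, and its cost is finite
    (∃ g : MajorMinor.Strategy S, g.IsOptimal ξ μ ∧ g.J ξ μ ≠ ⊤) ∧
    -- a strategy is optimal exactly when its control split has the stated form
    (∀ g : MajorMinor.Strategy S, g.IsOptimal ξ μ ↔
      ∀ t < S.N,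
        MeasureTheory.Integrable (g.control ξ t) μ ∧
        (∀ᵐ ω ∂μ, g.ucom ξ μ t ω = -(S.Lcom t *ᵥ g.zhatCom ξ μ t ω)) ∧
        ∀ i : Fin n, ∀ᵐ ω ∂μ,
          MajorMinor.blk (g.uloc ξ μ t ω) (some i) = -(S.Lloc i t *ᵥ g.zhatLoc ξ μ i t ω)) ∧
    -- the optimal strategy is unique: as a control process, and as control laws up to null
    -- sets for the distribution of the information
    (∀ g g' : MajorMinor.Strategy S, g.IsOptimal ξ μ → g'.IsOptimal ξ μ →
      ∀ t < S.N,
        (∀ᵐ ω ∂μ, g.control ξ t ω = g'.control ξ t ω) ∧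
        (∀ᵐ I ∂(μ.map (g.infoMajor ξ t)), g.major t I = g'.major t I) ∧
        ∀ i : Fin n, ∀ᵐ I ∂(μ.map (g.infoMinor ξ i t)), g.minor i t I = g'.minor i t I) := by
  refine ⟨?_, fun g => (g.isOptimal_iff_isFeedback hξ).trans (g.isFeedback_iff hξ), ?_⟩
  · obtain ⟨g, hg⟩ := hξ.exists_isFeedback
    exact ⟨g, hg.isOptimal hξ, (hg.J_eq hξ).trans_ne ENNReal.ofReal_ne_top⟩
  · intro g g' hg hg' t ht
    have h : ∀ t < S.N, g.control ξ t =ᵐ[μ] g'.control ξ t := fun t ht =>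
      ((g.isOptimal_iff_isFeedback hξ).1 hg).control_ae_eq hξ
        ((g'.isOptimal_iff_isFeedback hξ).1 hg') ht
    exact ⟨h t ht, MajorMinor.Strategy.laws_ae_eq hξ h ht⟩
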